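/- **The problem.** An instance of Shift Bribery over a Social Network with two candidates consists of a set of $n$ voters, a vote (linear order over the two candidates) for each voter, a network on the voters with arc set $A$ and weights $w : A \to \mathbb{R}_{\ge 0}$, a preferred candidate $c$, for each voter $i$ a cost function $\pi_i : \{0,1\} \to \mathbb{N}$ with $\pi_i(0)=0$, and a budget $b \in \mathbb{R}_{\ge 0}$. A shift vector $s = (s_i)$ with $s_i \in \{0,1\}$ costs $\sum_i \pi_i(s_i)$; applying it moves $c$ forward in the vote of every voter $i$ by $s_i' = s_i + \sum_{j \ne i,\ (j,i)\in A} \lfloor s_j\, w(j,i)\rfloor$ positions (or to the top, if there are fewer positions above $c$). The question is whether some shift vector of cost at most $b$ makes $c$ a majority winner, i.e. ranked first by at least $\lceil (n+1)/2\rceil$ voters. We consider instances in which the network is undirected ($(u,v) \in A$ implies $(v,u) \in A$), the weights are uniform ($w \equiv 1$ on $A$) and the costs are linear ($\pi_i(s) = a_i s$ with $a_i \in \mathbb{N}$). A cluster graph is a disjoint union of cliques; the cluster vertex deletion number $k$ of a graph is the least number of vertices whose deletion leaves a cluster graph. **The machine.** Algorithms are programs of a random access machine over the natural numbers with registers and two-dimensional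 arrays, in which each addition, truncated subtraction, division with remainder, comparison and memory access takes unit time (there is no multiplication). The input is $n$, $c$, $\lfloor b \rfloor$, the adjacency matrix, the votes, and the prices $\pi_i(1)$. **Theorem.** For instances with two candidates, undirected networks, uniform edge weights and linear costs: 1. For every constant $k$ there are an algorithm and constants $C, d \in \mathbb{N}$ such that the algorithm decides every instance whose network has cluster vertex deletion number at most $k$ in time at most $C\,(n + \lfloor b\rfloor + 1)^d$. That is, the problem is solvable in pseudo-polynomial time when the cluster vertex deletion number is bounded by a constant. 2. The problem is pseudo-fixed-parameter tractable in the cluster vertex deletion number: there are a single algorithm, a computable function $f : \mathbb{N} \to \mathbb{N}$ and a constant $d \in \mathbb{N}$ such that the algorithm decides every instance in time at most $f(k)\,(n + \lfloor b\rfloor + 1)^d$, where $k$ is the cluster vertex deletion number of its network. Neither $k$ nor a deletion set is given to the algorithm. -/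

import Mathlib

/-! ## The election model -/

namespace ShiftBribery

open scoped NNReal

/-- A vote over the candidates `Fin m`: the bijection that sends a candidate to its rank,
rank `0` being the top position. (Linear orders on the `m` candidates are exactly these.) -/
abbrev Vote (m : ℕ) : Type := Equiv.Perm (Fin m)

/-- The vote obtained from `σ` by moving the candidate `c` to the left by `s` positions, or to the
top if `c` has fewer than `s` candidates above it. If `c` had rank `p` and gets rank `q = p - s`
(truncated at `0`), the candidates of ranks `q, …, p - 1` move one position to the right. -/
def Vote.shift {m : ℕ} (σ : Vote m) (c : Fin m) (s : ℕ) : Vote m :=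
  σ.trans (Fin.cycleIcc ⟨(σ c : ℕ) - s, lt_of_le_of_lt (Nat.sub_le _ _) (σ c).isLt⟩ (σ c))

/-- An instance of Shift Bribery over a Social Network with candidates `Fin m` and voters `Fin n`.
The weight function is only ever evaluated on arcs, and `cost v s` is the price for shifting
the preferred candidate by `s` positions, `0 ≤ s ≤ m - 1`, in the vote of `v`. -/
structure Instance (m n : ℕ) where
  vote : Fin n → Vote m
  arc : Fin n → Fin n → Prop
  weight : Fin n → Fin n → ℝ≥0
  preferred : Fin m
  cost : Fin n → Fin m → ℕ
  cost_zero : ∀ v (s : Fin m), (s : ℕ) = 0 → cost v s = 0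
  budget : ℝ≥0

namespace Instance

variable {m n : ℕ}

open Classical in
/-- The total shift of voter `i`: its own shift together with the influence of its in-neighbours. -/
noncomputable def effectiveShift (I : Instance m n) (s : Fin n → Fin m) (i : Fin n) : ℕ :=
  (s i : ℕ) + ∑ j : Fin n with j ≠ i ∧ I.arc j i, ⌊((s j : ℕ) : ℝ≥0) * I.weight j i⌋₊

/-- The profile that results from applying the shift vector `s` on the network. -/
noncomputable def resultingProfile (I : Instance m n) (s : Fin n → Fin m) : Fin n → Vote m :=
  fun i => (I.vote i).shift I.preferred (I.effectiveShift s i)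

/-- The candidate `c` wins the profile `Q` under the majority rule: it is ranked first by more
than half of the voters, that is, by at least `⌈(n + 1) / 2⌉` of them. -/
def MajorityWinner (Q : Fin n → Vote m) (c : Fin m) : Prop :=
  n < 2 * (Finset.univ.filter fun i : Fin n => (Q i c : ℕ) = 0).card

/-- Some shift vector within the budget makes the preferred candidate a majority winner. -/
def IsYes (I : Instance m n) : Prop :=
  ∃ s : Fin n → Fin m,
    ((∑ v, I.cost v (s v) : ℕ) : ℝ≥0) ≤ I.budget ∧
      MajorityWinner (I.resultingProfile s) I.preferred

/-- The network is undirected: its arcs come in opposite pairs. -/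
def Undirected (I : Instance m n) : Prop := ∀ u v, I.arc u v → I.arc v u

/-- Every edge has weight `1`. -/
def UniformWeights (I : Instance m n) : Prop := ∀ u v, I.arc u v → I.weight u v = 1

/-- Every voter has a linear cost function, with a slope of its own. -/
def LinearCosts (I : Instance m n) : Prop :=
  ∃ a : Fin n → ℕ, ∀ v (s : Fin m), I.cost v s = a v * (s : ℕ)

/-- The underlying simple graph of the network. -/
def graph (I : Instance m n) : SimpleGraph (Fin n) := SimpleGraph.fromRel I.arc

end Instance

/-! ## Cluster graphs -/

/-- A cluster graph is a disjoint union of cliques: two distinct vertices in the same connected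
component are adjacent. -/
def IsClusterGraph {V : Type*} (G : SimpleGraph V) : Prop :=
  ∀ u v, G.Reachable u v → u ≠ v → G.Adj u v

/-- The least number of vertices whose deletion leaves a cluster graph. -/
noncomputable def clusterVertexDeletionNumber {n : ℕ} (G : SimpleGraph (Fin n)) : ℕ :=
  sInf {k | ∃ X : Finset (Fin n), X.card = k ∧ IsClusterGraph (G.induce ((X : Set (Fin n))ᶜ))}

/-! ## The machine model

A random access machine over the natural numbers, with scalar registers `r₀, r₁, …` and
two-dimensional arrays `A₀, A₁, …`; a program mentions only finitely many of them.
Every operation takes one time unit. There is no multiplication, so a value grows by at most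
one bit per time unit, and the machine is polynomially equivalent to a Turing machine. -/

/-- Memory contents. -/
structure Store where
  reg : ℕ → ℕ
  arr : ℕ → ℕ → ℕ → ℕ

/-- Arithmetic expressions. -/
inductive Expr where
  | lit (c : ℕ)
  | reg (x : ℕ)
  | arr (a : ℕ) (i j : Expr)
  | add (e₁ e₂ : Expr)
  | sub (e₁ e₂ : Expr)
  | div (e₁ e₂ : Expr)
  | mod (e₁ e₂ : Expr)
  | lt (e₁ e₂ : Expr)

/-- The value of an expression: `sub` is truncated subtraction, and `lt` is `1` or `0`. -/
def Expr.eval (S : Store) : Expr → ℕ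
  | .lit c => c
  | .reg x => S.reg x
  | .arr a i j => S.arr a (i.eval S) (j.eval S)
  | .add e₁ e₂ => e₁.eval S + e₂.eval S
  | .sub e₁ e₂ => e₁.eval S - e₂.eval S
  | .div e₁ e₂ => e₁.eval S / e₂.eval S
  | .mod e₁ e₂ => e₁.eval S % e₂.eval S
  | .lt e₁ e₂ => if e₁.eval S < e₂.eval S then 1 else 0

/-- The time for evaluating an expression: one unit per operation, constant and access. -/
def Expr.time : Expr → ℕ
  | .lit _ => 1
  | .reg _ => 1
  | .arr _ i j => i.time + j.time + 1
  | .add e₁ e₂ => e₁.time + e₂.time + 1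
  | .sub e₁ e₂ => e₁.time + e₂.time + 1
  | .div e₁ e₂ => e₁.time + e₂.time + 1
  | .mod e₁ e₂ => e₁.time + e₂.time + 1
  | .lt e₁ e₂ => e₁.time + e₂.time + 1

/-- Programs; a condition holds if its value is not `0`. -/
inductive Program where
  | skip
  | setReg (x : ℕ) (e : Expr)
  | setArr (a : ℕ) (i j e : Expr)
  | seq (p q : Program)
  | ite (e : Expr) (p q : Program)
  | while (e : Expr) (p : Program)

/-- Overwrite a register. -/
def Store.setReg (S : Store) (x v : ℕ) : Store :=
  { S with reg := Function.update S.reg x v }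

/-- Overwrite an array cell. -/
def Store.setArr (S : Store) (a i j v : ℕ) : Store :=
  { S with arr := fun a' i' j' => if a' = a ∧ i' = i ∧ j' = j then v else S.arr a' i' j' }

/-- `Exec p S S' t`: started on `S`, the program `p` halts with memory `S'` after `t` time units. -/
inductive Exec : Program → Store → Store → ℕ → Prop where
  | skip (S) : Exec .skip S S 1
  | setReg (x e S) : Exec (.setReg x e) S (S.setReg x (e.eval S)) (e.time + 1)
  | setArr (a i j e S) :
      Exec (.setArr a i j e) S (S.setArr a (i.eval S) (j.eval S) (e.eval S))
        (i.time + j.time + e.time + 1)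
  | seq {p q S S' S'' t t'} : Exec p S S' t → Exec q S' S'' t' →
      Exec (.seq p q) S S'' (t + t')
  | iteTrue {e p q S S' t} : e.eval S ≠ 0 → Exec p S S' t →
      Exec (.ite e p q) S S' (e.time + 1 + t)
  | iteFalse {e p q S S' t} : e.eval S = 0 → Exec q S S' t →
      Exec (.ite e p q) S S' (e.time + 1 + t)
  | whileTrue {e p S S' S'' t t'} : e.eval S ≠ 0 → Exec p S S' t →
      Exec (.while e p) S' S'' t' → Exec (.while e p) S S'' (e.time + 1 + t + t')
  | whileFalse {e p S} : e.eval S = 0 → Exec (.while e p) S S (e.time + 1)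

/-! ## Solving the problem on the machine -/

open Classical in
/-- The input of the machine for an instance with two candidates, uniform weights and linear costs:
the number of voters, the preferred candidate, the budget (whose integer part is all that matters,
since prices are natural numbers), the adjacency matrix, the ranks of the two candidates in each
vote, and the price of a shift by one position for each voter. All other memory is `0`. -/
noncomputable def Instance.input {n : ℕ} (I : Instance 2 n) : Store where
  reg x :=
    if x = 0 then n
    else if x = 1 then (I.preferred : ℕ)
    else if x = 2 then ⌊I.budget⌋₊
    else 0
  arr a i j :=
    if hi : i < n then
      if a = 0 then (if hj : j < n then (if I.arc ⟨i, hi⟩ ⟨j, hj⟩ then 1 else 0) else 0)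
      else if a = 1 then (if hj : j < 2 then (I.vote ⟨i, hi⟩ ⟨j, hj⟩ : ℕ) else 0)
      else if a = 2 then (if j = 0 then I.cost ⟨i, hi⟩ 1 else 0)
      else 0
    else 0

/-- Started on the input, `p` halts within `T` time units, with `1` in register `0` if the answer
is yes and `0` if it is no. -/
def Program.DecidesWithin (p : Program) {n : ℕ} (I : Instance 2 n) (T : ℕ) : Prop :=
  ∃ S t, Exec p I.input S t ∧ t ≤ T ∧
    ((I.IsYes ∧ S.reg 0 = 1) ∨ (¬ I.IsYes ∧ S.reg 0 = 0))

/-- The size in which pseudo-polynomial running times are measured: the number of voters plus the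
value (not the bit length) of the budget, plus one to make it positive. -/
noncomputable def Instance.pseudoSize {n : ℕ} (I : Instance 2 n) : ℕ := n + ⌊I.budget⌋₊ + 1

end ShiftBribery

/-! With two candidates every vote has the preferred candidate at rank `0` or `1`, so a voter is won
exactly when it already ranks that candidate first, is bought, or has a bought neighbour. The
question becomes budgeted partial domination: is there a set `S` of price at most `⌊b⌋` such that
more than half of the vertices are on top from the start or lie in the closed neighbourhood of `S`?

A graph is a cluster graph iff it has no induced path on three vertices. Collecting vertex-disjoint
induced paths greedily gives a set `X` whose deletion leaves cliques. Every deletion set contains a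
vertex of each collected path, so `|X| ≤ 3k`, although neither `k` nor a deletion set is known
(`Packing`, `run_takePaths`, `Instance.net_hits`).

The part `G` of `X` that is bought is guessed, among `2 ^ |X|` possibilities. The cliques are then
added one at a time to a table indexed by the number `m` of won vertices and the code `D` of the won
part of `X`; an entry is the largest unspent budget plus one, with `0` for "impossible". This state
suffices: a vertex outside `X` dominates only vertices of its own clique and of `X`. The first
vertex bought in a clique wins all of the clique that `G` has not won, and each further one wins
vertices of `X` only; what is new in `X` depends on `D` alone (`count_insert_first`,
`count_insert_again`, `code_insert`). `Sound` and `Complete` are the two halves of the correctness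
of a table, and `isYes_iff` and `wins_iff` turn the final tables into the answer.

The algorithm uses only counting loops, whose bounds are `n`, `n + 1` and `2 ^ |X|`. A structural
induction (`exists_exec`) makes the running time of such a program polynomial in a common bound of
these numbers, here `2 ^ (3k) * pseudoSize`. This one program proves both claims. -/

namespace ShiftBribery

/-! ## Bounded loops over the machine -/

/-- Negation of a truth value. -/
def Expr.not (e : Expr) : Expr := .lt e (.lit 1)

/-- Conjunction of truth values. -/
def Expr.and (e f : Expr) : Expr := .lt (.lit 1) (.add (.lt (.lit 0) e) (.lt (.lit 0) f))

/-- Equality test. -/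
def Expr.eq (e f : Expr) : Expr := .lt (.add (.lt e f) (.lt f e)) (.lit 1)

/-- Maximum. -/
def Expr.max (e f : Expr) : Expr := .add e (.sub f e)

theorem Expr.eval_not {S : Store} {e : Expr} : e.not.eval S ≠ 0 ↔ e.eval S = 0 := by
  simp [Expr.not, Expr.eval]

theorem Expr.eval_and {S : Store} {e f : Expr} :
    (e.and f).eval S ≠ 0 ↔ e.eval S ≠ 0 ∧ f.eval S ≠ 0 := by
  by_cases he : e.eval S = 0 <;> by_cases hf : f.eval S = 0 <;>
    simp [Expr.and, Expr.eval, he, hf, Nat.pos_iff_ne_zero]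

theorem Expr.eval_eq {S : Store} {e f : Expr} : (e.eq f).eval S ≠ 0 ↔ e.eval S = f.eval S := by
  simp only [Expr.eq, Expr.eval]
  split_ifs <;> omega

theorem Expr.eval_max {S : Store} {e f : Expr} :
    (e.max f).eval S = Max.max (e.eval S) (f.eval S) := by
  simp only [Expr.max, Expr.eval]
  omega

theorem Expr.eval_lt {S : Store} {e f : Expr} :
    (e.lt f).eval S ≠ 0 ↔ e.eval S < f.eval S := by
  simp [Expr.eval]

/-- Programs all of whose loops are counting loops: `loop x b p` runs `p` with `x` counting from
`0` up to the contents of register `b`. -/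
inductive LoopProgram where
  | skip
  | setReg (x : ℕ) (e : Expr)
  | setArr (a : ℕ) (i j e : Expr)
  | seq (p q : LoopProgram)
  | ite (e : Expr) (p q : LoopProgram)
  | loop (x b : ℕ) (p : LoopProgram)

infixr:60 " ;; " => LoopProgram.seq

namespace LoopProgram

/-- One-armed conditional. -/
def when (e : Expr) (p : LoopProgram) : LoopProgram := .ite e p .skip

/-- The underlying program. -/
def compile : LoopProgram → Program
  | .skip => .skip
  | .setReg x e => .setReg x e
  | .setArr a i j e => .setArr a i j e
  | .seq p q => .seq p.compile q.compile
  | .ite e p q => .ite e p.compile q.compile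
  | .loop x b p => .seq (.setReg x (.lit 0)) (.while (.lt (.reg x) (.reg b))
      (.seq p.compile (.setReg x (.add (.reg x) (.lit 1)))))

/-- Repeating `f` on the store `N` times, counting in the register `x`. -/
def iterate (x : ℕ) (f : Store → Store) : ℕ → Store → Store
  | 0, S => S.setReg x 0
  | N + 1, S => (f (iterate x f N S)).setReg x (N + 1)

/-- The memory after running a program. -/
def run : LoopProgram → Store → Store
  | .skip, S => S
  | .setReg x e, S => S.setReg x (e.eval S)
  | .setArr a i j e, S => S.setArr a (i.eval S) (j.eval S) (e.eval S)
  | .seq p q, S => q.run (p.run S)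
  | .ite e p q, S => if e.eval S ≠ 0 then p.run S else q.run S
  | .loop x b p, S => iterate x p.run (S.reg b) S

theorem run_seq (p q : LoopProgram) (S : Store) : (p ;; q).run S = q.run (p.run S) := rfl

theorem run_setReg (x : ℕ) (e : Expr) (S : Store) :
    (LoopProgram.setReg x e).run S = S.setReg x (e.eval S) := rfl

/-- Whether the program writes to the register `y`. -/
def writesReg (y : ℕ) : LoopProgram → Bool
  | .skip => false
  | .setReg x _ => x == y
  | .setArr _ _ _ _ => false
  | .seq p q => p.writesReg y || q.writesReg y
  | .ite _ p q => p.writesReg y || q.writesReg y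
  | .loop x _ p => x == y || p.writesReg y

/-- Whether the program writes to the array `y`. -/
def writesArr (y : ℕ) : LoopProgram → Bool
  | .skip => false
  | .setReg _ _ => false
  | .setArr a _ _ _ => a == y
  | .seq p q => p.writesArr y || q.writesArr y
  | .ite _ p q => p.writesArr y || q.writesArr y
  | .loop _ _ p => p.writesArr y

/-- Loops count in registers that their bodies leave alone, and the bound of every loop is one of
the registers in `B`, which are never written. -/
def bounded (B : List ℕ) : LoopProgram → Bool
  | .skip => true
  | .setReg x _ => !B.contains x
  | .setArr _ _ _ _ => true
  | .seq p q => p.bounded B && q.bounded B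
  | .ite _ p q => p.bounded B && q.bounded B
  | .loop x b p => B.contains b && !B.contains x && !p.writesReg x && p.bounded B

end LoopProgram

/-! ### Memory updates, frame conditions and loop invariants. -/

namespace Store

@[simp] theorem setReg_reg (S : Store) (x v y : ℕ) :
    (S.setReg x v).reg y = if y = x then v else S.reg y := by
  simp [Store.setReg, Function.update_apply]

@[simp] theorem setReg_arr (S : Store) (x v : ℕ) : (S.setReg x v).arr = S.arr := rfl

@[simp] theorem setArr_reg (S : Store) (a i j v : ℕ) : (S.setArr a i j v).reg = S.reg := rfl

@[simp] theorem setArr_arr (S : Store) (a i j v a' i' j' : ℕ) : (S.setArr a i j v).arr a' i' j' =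
    if a' = a ∧ i' = i ∧ j' = j then v else S.arr a' i' j' := rfl

theorem setArr_arr_of_ne (S : Store) {a a' : ℕ} (h : a' ≠ a) (i j v : ℕ) :
    (S.setArr a i j v).arr a' = S.arr a' := by
  funext i' j'
  simp [h]

end Store

namespace LoopProgram

theorem run_reg {y : ℕ} (p : LoopProgram) (S : Store) (h : p.writesReg y = false) :
    (p.run S).reg y = S.reg y := by
  induction p generalizing S with
  | skip => rfl
  | setReg x e =>
    have : y ≠ x := by rintro rfl; simp [writesReg] at h
    simp [run, this]
  | setArr => rfl
  | seq p q hp hq =>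
    simp only [writesReg, Bool.or_eq_false_iff] at h
    simp [run, hp _ h.1, hq _ h.2]
  | ite e p q hp hq =>
    simp only [writesReg, Bool.or_eq_false_iff] at h
    simp only [run]
    split_ifs
    · exact hp _ h.1
    · exact hq _ h.2
  | loop x b p hp =>
    simp only [writesReg, Bool.or_eq_false_iff, beq_eq_false_iff_ne] at h
    have hy : y ≠ x := fun e => h.1 e.symm
    simp only [run]
    induction S.reg b with
    | zero => simp [iterate, hy]
    | succ N ih => simp [iterate, hy, hp _ h.2, ih]

theorem run_arr {y : ℕ} (p : LoopProgram) (S : Store) (h : p.writesArr y = false) :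
    (p.run S).arr y = S.arr y := by
  induction p generalizing S with
  | skip => rfl
  | setReg x e => rfl
  | setArr a i j e =>
    have : y ≠ a := by rintro rfl; simp [writesArr] at h
    simp [run, Store.setArr_arr_of_ne _ this]
  | seq p q hp hq =>
    simp only [writesArr, Bool.or_eq_false_iff] at h
    simp [run, hp _ h.1, hq _ h.2]
  | ite e p q hp hq =>
    simp only [writesArr, Bool.or_eq_false_iff] at h
    simp only [run]
    split_ifs
    · exact hp _ h.1
    · exact hq _ h.2
  | loop x b p hp =>
    simp only [writesArr] at h
    simp only [run]
    induction S.reg b with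
    | zero => simp [iterate]
    | succ N ih => simp [iterate, hp _ h, ih]

/-- Hence a loop bound keeps its initial value throughout the run, and a bound on the initial values
of these registers controls every loop. -/
theorem writesReg_of_bounded {B : List ℕ} {b : ℕ} (hb : b ∈ B) (p : LoopProgram)
    (h : p.bounded B) : p.writesReg b = false := by
  induction p with
  | skip => rfl
  | setReg x e =>
    simp only [bounded, Bool.not_eq_true', List.contains_eq_mem, decide_eq_false_iff_not] at h
    simp only [writesReg, beq_eq_false_iff_ne]
    rintro rfl
    exact h hb
  | setArr => rfl
  | seq p q hp hq =>
    simp only [bounded, Bool.and_eq_true] at h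
    simp [writesReg, hp h.1, hq h.2]
  | ite e p q hp hq =>
    simp only [bounded, Bool.and_eq_true] at h
    simp [writesReg, hp h.1, hq h.2]
  | loop x c p hp =>
    simp only [bounded, Bool.and_eq_true, Bool.not_eq_true', List.contains_eq_mem,
      decide_eq_false_iff_not] at h
    simp only [writesReg, Bool.or_eq_false_iff, beq_eq_false_iff_ne]
    refine ⟨?_, hp h.2⟩
    rintro rfl
    exact h.1.1.2 hb

/-- `S'` agrees with `S` on everything that the program does not write. -/
structure Frame (p : LoopProgram) (S S' : Store) : Prop where
  reg : ∀ y, p.writesReg y = false → S'.reg y = S.reg y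
  arr : ∀ a, p.writesArr a = false → S'.arr a = S.arr a

theorem frame_run (p : LoopProgram) (S : Store) : p.Frame S (p.run S) :=
  ⟨fun _ h => run_reg p S h, fun _ h => run_arr p S h⟩

theorem Frame.trans {p : LoopProgram} {S₁ S₂ S₃ : Store} (h₁ : p.Frame S₁ S₂)
    (h₂ : p.Frame S₂ S₃) : p.Frame S₁ S₃ :=
  ⟨fun y hy => (h₂.reg y hy).trans (h₁.reg y hy),
    fun a ha => (h₂.arr a ha).trans (h₁.arr a ha)⟩

theorem Frame.loop {p : LoopProgram} {S S' : Store} (h : p.Frame S S') (x b : ℕ) :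
    (loop x b p).Frame S S' := by
  refine ⟨fun y hy => h.reg y ?_, fun a ha => h.arr a ha⟩
  simp only [writesReg, Bool.or_eq_false_iff] at hy
  exact hy.2

theorem frame_iterate {x b : ℕ} {p : LoopProgram} (N : ℕ) (S : Store) :
    (loop x b p).Frame S (iterate x p.run N S) := by
  induction N with
  | zero =>
    refine ⟨fun y hy => ?_, fun a _ => rfl⟩
    simp only [writesReg, Bool.or_eq_false_iff, beq_eq_false_iff_ne] at hy
    simp [iterate, hy.1.symm]
  | succ N ih =>
    refine ⟨fun y hy => ?_, fun a ha => ?_⟩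
    · have hy' := hy
      simp only [writesReg, Bool.or_eq_false_iff, beq_eq_false_iff_ne] at hy
      simp [iterate, hy.1.symm, run_reg _ _ hy.2, ih.reg y hy']
    · have ha' := ha
      simp only [writesArr] at ha
      simp [iterate, run_arr _ _ ha, ih.arr a ha']

/-- The induction rule for counting loops. -/
theorem loop_induction {x b : ℕ} {p : LoopProgram} {S : Store} (I : ℕ → Store → Prop)
    (h0 : I 0 (S.setReg x 0))
    (hs : ∀ i < S.reg b, ∀ S', (loop x b p).Frame S S' → S'.reg x = i → I i S' →
      I (i + 1) ((p.run S').setReg x (i + 1))) :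
    I (S.reg b) ((loop x b p).run S) := by
  suffices h : ∀ N ≤ S.reg b, I N (iterate x p.run N S) from h _ le_rfl
  intro N hN
  induction N with
  | zero => exact h0
  | succ N ih =>
    refine hs N hN _ (frame_iterate N S) ?_ (ih (by omega))
    cases N <;> simp [iterate]

/-- The induction rule for counting loops, with a consequence of the invariant. -/
theorem loop_rule {x b : ℕ} {p : LoopProgram} {S : Store} {P : Store → Prop}
    (I : ℕ → Store → Prop) (h0 : I 0 (S.setReg x 0))
    (hs : ∀ i < S.reg b, ∀ S', (LoopProgram.loop x b p).Frame S S' → S'.reg x = i → I i S' →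
      I (i + 1) ((p.run S').setReg x (i + 1)))
    (hP : ∀ S', (LoopProgram.loop x b p).Frame S S' → I (S.reg b) S' → P S') :
    P ((LoopProgram.loop x b p).run S) :=
  hP _ (frame_run _ _) (loop_induction I h0 hs)

/-- A loop whose body makes progress with respect to a preorder of stores. -/
theorem loop_collect {x b : ℕ} {p : LoopProgram} {S : Store} (Inv : Store → Prop)
    (le : Store → Store → Prop) (R : ℕ → Store → Prop)
    (htrans : ∀ S₁ S₂ S₃, le S₁ S₂ → le S₂ S₃ → le S₁ S₃)
    (hR : ∀ i S₁ S₂, le S₁ S₂ → R i S₁ → R i S₂)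
    (hle : ∀ S v, le S (S.setReg x v)) (hInv : ∀ S v, Inv S → Inv (S.setReg x v))
    (h0 : Inv S)
    (hs : ∀ i < S.reg b, ∀ S', (loop x b p).Frame S S' → S'.reg x = i → Inv S' →
      Inv (p.run S') ∧ le S' (p.run S') ∧ R i (p.run S')) :
    Inv ((loop x b p).run S) ∧ le S ((loop x b p).run S) ∧
      ∀ i < S.reg b, R i ((loop x b p).run S) := by
  refine loop_induction (S := S) (x := x) (b := b) (p := p)
    (fun N S' => Inv S' ∧ le S S' ∧ ∀ i < N, R i S') ⟨hInv _ _ h0, hle _ _, by simp⟩ ?_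
  rintro i hi S' hf hx ⟨h1, h2, h3⟩
  obtain ⟨k1, k2, k3⟩ := hs i hi S' hf hx h1
  have hk : le S' ((p.run S').setReg x (i + 1)) := htrans _ _ _ k2 (hle _ _)
  refine ⟨hInv _ _ k1, htrans _ _ _ h2 hk, fun j hj => ?_⟩
  rcases Nat.lt_succ_iff_lt_or_eq.1 hj with hj | rfl
  · exact hR _ _ _ hk (h3 j hj)
  · exact hR _ _ _ (hle _ _) k3

/-- Induction on the number `k` of rounds still to come. A round costs `4` for the test, at most `T`
for the body and `4` for the increment; the failing last test costs `4`. The body is only assumed to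
be fast on stores that agree with `S₀` on the registers it does not write, which include the bounds
of inner loops. -/
theorem exec_while {x b : ℕ} {p : LoopProgram} {T N : ℕ} (hxb : x ≠ b)
    (hx : p.writesReg x = false) (hb : p.writesReg b = false) (S₀ : Store) (hN : S₀.reg b = N)
    (hp : ∀ S : Store, (∀ y, p.writesReg y = false → y ≠ x → S.reg y = S₀.reg y) →
      ∃ t ≤ T, Exec p.compile S (p.run S) t) :
    ∀ k i, i + k = N → ∃ t ≤ k * (T + 8) + 4,
      Exec (.while (.lt (.reg x) (.reg b))
        (.seq p.compile (.setReg x (.add (.reg x) (.lit 1)))))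
        (iterate x p.run i S₀) (iterate x p.run N S₀) t := by
  have hreg : ∀ i, (iterate x p.run i S₀).reg x = i := by
    intro i; cases i <;> simp [iterate]
  have hfr : ∀ i y, p.writesReg y = false → y ≠ x →
      (iterate x p.run i S₀).reg y = S₀.reg y := by
    intro i y hy hyx
    induction i with
    | zero => simp [iterate, hyx]
    | succ i ih => simp [iterate, hyx, run_reg _ _ hy, ih]
  intro k
  induction k with
  | zero =>
    intro i hi
    obtain rfl : i = N := by omega
    refine ⟨4, by omega, Exec.whileFalse ?_⟩
    simp [Expr.eval, hreg, hfr i b hb hxb.symm, hN]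
  | succ k ih =>
    intro i hi
    obtain ⟨t, ht, he⟩ := hp (iterate x p.run i S₀) (hfr i)
    obtain ⟨t', ht', he'⟩ := ih (i + 1) (by omega)
    refine ⟨_, ?_, Exec.whileTrue ?_ (Exec.seq he (Exec.setReg x _ _)) (t' := t') ?_⟩
    · simp only [Expr.time]
      linarith
    · simp only [Expr.eval, hreg, hfr i b hb hxb.symm, hN]
      rw [if_pos (by omega)]
      exact one_ne_zero
    · simpa [Expr.eval, iterate, run_reg _ _ hx, hreg] using he'

/-- The running time is polynomial in the bounds of the loops. -/
theorem exists_exec {B : List ℕ} (p : LoopProgram) (h : p.bounded B) :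
    ∃ c d : ℕ, ∀ M ≥ 1, ∀ S : Store, (∀ b ∈ B, S.reg b ≤ M) →
      ∃ t ≤ c * M ^ d, Exec p.compile S (p.run S) t := by
  induction p with
  | skip => exact ⟨1, 0, fun M _ S _ => ⟨1, by simp, Exec.skip S⟩⟩
  | setReg x e => exact ⟨e.time + 1, 0, fun M _ S _ => ⟨_, by simp, Exec.setReg x e S⟩⟩
  | setArr a i j e =>
    exact ⟨i.time + j.time + e.time + 1, 0, fun M _ S _ => ⟨_, by simp, Exec.setArr a i j e S⟩⟩
  | seq p q hp hq =>
    simp only [bounded, Bool.and_eq_true] at h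
    obtain ⟨c, d, hp⟩ := hp h.1
    obtain ⟨c', d', hq⟩ := hq h.2
    refine ⟨c + c', d + d', fun M hM S hS => ?_⟩
    obtain ⟨t, ht, he⟩ := hp M hM S hS
    obtain ⟨t', ht', he'⟩ := hq M hM (p.run S) (fun b hb => by
      rw [run_reg _ _ (writesReg_of_bounded hb p h.1)]; exact hS b hb)
    refine ⟨t + t', ?_, Exec.seq he he'⟩
    have h1 : M ^ d ≤ M ^ (d + d') := Nat.pow_le_pow_right hM (by omega)
    have h2 : M ^ d' ≤ M ^ (d + d') := Nat.pow_le_pow_right hM (by omega)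
    calc t + t' ≤ c * M ^ d + c' * M ^ d' := add_le_add ht ht'
      _ ≤ c * M ^ (d + d') + c' * M ^ (d + d') := by gcongr
      _ = _ := by ring
  | ite e p q hp hq =>
    simp only [bounded, Bool.and_eq_true] at h
    obtain ⟨c, d, hp⟩ := hp h.1
    obtain ⟨c', d', hq⟩ := hq h.2
    refine ⟨e.time + 1 + c + c', d + d', fun M hM S hS => ?_⟩
    have h0 : 1 ≤ M ^ (d + d') := Nat.one_le_pow _ _ hM
    have h1 : M ^ d ≤ M ^ (d + d') := Nat.pow_le_pow_right hM (by omega)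
    have h2 : M ^ d' ≤ M ^ (d + d') := Nat.pow_le_pow_right hM (by omega)
    have h3 : ∀ s, s ≤ c * M ^ (d + d') + c' * M ^ (d + d') →
        e.time + 1 + s ≤ (e.time + 1 + c + c') * M ^ (d + d') := fun s hs => by nlinarith
    by_cases hc : e.eval S = 0
    · obtain ⟨t, ht, he⟩ := hq M hM S hS
      refine ⟨_, ?_, by simpa [run, compile, hc] using Exec.iteFalse hc he⟩
      exact h3 _ (ht.trans (le_add_left (by gcongr)))
    · obtain ⟨t, ht, he⟩ := hp M hM S hS
      refine ⟨_, ?_, by simpa [run, compile, hc] using Exec.iteTrue hc he⟩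
      exact h3 _ (ht.trans (le_add_right (by gcongr)))
  | loop x b p hp =>
    simp only [bounded, Bool.and_eq_true, Bool.not_eq_true', List.contains_eq_mem,
      decide_eq_false_iff_not, decide_eq_true_eq] at h
    obtain ⟨⟨⟨hb, hx⟩, hw⟩, hB⟩ := h
    obtain ⟨c, d, hp⟩ := hp hB
    -- The constant is `8` per round, `4` for the last test and `2` for resetting the counter, each
    -- absorbed into the term `M * M ^ d`.
    refine ⟨c + 14, d + 1, fun M hM S hS => ?_⟩
    have hxb : x ≠ b := by rintro rfl; exact hx hb
    have hbw := writesReg_of_bounded hb p hB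
    obtain ⟨t, ht, he⟩ := exec_while (T := c * M ^ d) hxb hw hbw S rfl (fun S' hS' =>
      hp M hM S' (fun y hy => by
        rw [hS' y (writesReg_of_bounded hy p hB) (by rintro rfl; exact hx hy)]
        exact hS y hy)) (S.reg b) 0 (by omega)
    refine ⟨2 + t, ?_, Exec.seq (Exec.setReg x (.lit 0) S) he⟩
    have h1 : 1 ≤ M ^ d := Nat.one_le_pow _ _ hM
    have h2 : S.reg b ≤ M := hS b hb
    have h3 : S.reg b * (c * M ^ d + 8) ≤ M * (c * M ^ d + 8 * M ^ d) := by gcongr; omega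
    have h4 : M ^ (d + 1) = M * M ^ d := by ring
    have h5 : 1 ≤ M * M ^ d := Nat.mul_pos hM h1
    rw [h4]
    nlinarith

end LoopProgram

/-! ## Dynamic programming over the clusters -/

/-- A network with a budget, prices, and a set of vertices that need no influence; `adj` contains
the loops, so that it is the relation of domination. -/
structure Net where
  n : ℕ
  budget : ℕ
  adj : ℕ → ℕ → Prop
  top : ℕ → Prop
  price : ℕ → ℕ

namespace Net

open scoped Classical

/-- The vertex `v` is won if the vertices in `S` are bought. -/
def Dominated (N : Net) (S : Finset ℕ) (v : ℕ) : Prop := N.top v ∨ ∃ u ∈ S, N.adj u v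

/-- The number of vertices won by `S`. -/
noncomputable def count (N : Net) (S : Finset ℕ) : ℕ :=
  ((Finset.range N.n).filter (N.Dominated S)).card

/-- The price of `S`. -/
def total (N : Net) (S : Finset ℕ) : ℕ := ∑ v ∈ S, N.price v

/-- Some affordable set wins more than half of the vertices. -/
def IsYes (N : Net) : Prop :=
  ∃ S ⊆ Finset.range N.n, N.total S ≤ N.budget ∧ N.n < 2 * N.count S

theorem count_le (N : Net) (S : Finset ℕ) : N.count S ≤ N.n :=
  (Finset.card_filter_le _ _).trans_eq (Finset.card_range _)

theorem dominated_insert (N : Net) (S : Finset ℕ) (v u : ℕ) :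
    N.Dominated (insert v S) u ↔ N.Dominated S u ∨ N.adj v u := by
  simp only [Dominated, Finset.mem_insert, exists_eq_or_imp]
  rw [or_assoc, or_comm (a := N.adj v u)]

/-- Only an inequality, since `v` may already be in `S`. It suffices for soundness, and it is what
makes updating a table in place harmless: paying twice for a vertex merely understates the unspent
budget. -/
theorem total_insert_le (N : Net) (S : Finset ℕ) (v : ℕ) :
    N.total (insert v S) ≤ N.total S + N.price v := by
  by_cases h : v ∈ S
  · simp [h]
  · simp [total, Finset.sum_insert h, add_comm]

end Net

/-- A set `X` whose deletion leaves a cluster graph: `rep` numbers the clusters from `1` on and is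
`0` on `X`; the weights `wt` encode the subsets of `X` as numbers below `size`. -/
structure Clustering (N : Net) where
  X : Finset ℕ
  rep : ℕ → ℕ
  wt : ℕ → ℕ
  size : ℕ
  subset : X ⊆ Finset.range N.n
  rep_eq_zero : ∀ v < N.n, rep v = 0 ↔ v ∈ X
  rep_le : ∀ v < N.n, rep v ≤ N.n
  adj_iff : ∀ u < N.n, ∀ v < N.n, u ∉ X → v ∉ X → (N.adj u v ↔ rep u = rep v)
  wt_eq_zero : ∀ v < N.n, wt v = 0 ↔ v ∉ X
  code_lt : ∀ Y ⊆ X, ∑ x ∈ Y, wt x < size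
  bit_code : ∀ Y ⊆ X, ∀ x ∈ X, (∑ y ∈ Y, wt y) / wt x % 2 ≠ 0 ↔ x ∈ Y

namespace Clustering

open scoped Classical

variable {N : Net} (C : Clustering N)

/-- The code of the part of `X` that is won by `S`. -/
noncomputable def code (S : Finset ℕ) : ℕ :=
  ∑ x ∈ (Finset.range N.n).filter (N.Dominated S), C.wt x

theorem code_eq (S : Finset ℕ) : C.code S = ∑ x ∈ C.X.filter (N.Dominated S), C.wt x := by
  refine (Finset.sum_subset (Finset.filter_subset_filter _ C.subset) ?_).symm
  intro x hx hx'
  simp only [Finset.mem_filter, Finset.mem_range] at hx hx'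
  exact (C.wt_eq_zero x hx.1).2 fun h => hx' ⟨h, hx.2⟩

theorem code_lt_size (S : Finset ℕ) : C.code S < C.size := by
  rw [code_eq]
  exact C.code_lt _ (Finset.filter_subset _ _)

theorem bit_code_iff (S : Finset ℕ) {x : ℕ} (hx : x < N.n) (h : C.wt x ≠ 0) :
    C.code S / C.wt x % 2 ≠ 0 ↔ N.Dominated S x := by
  have hX : x ∈ C.X := by
    by_contra h'
    exact h ((C.wt_eq_zero x hx).2 h')
  rw [code_eq, C.bit_code _ (Finset.filter_subset _ _) x hX, Finset.mem_filter]
  exact and_iff_right hX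

/-- The vertex `x` of `X` is adjacent to `v` and not encoded by `D`. -/
def New (v D x : ℕ) : Prop := C.wt x ≠ 0 ∧ N.adj v x ∧ D / C.wt x % 2 = 0

/-- The number of vertices of `X` that are won by adding `v`, if `D` encodes those already won. -/
noncomputable def newCount (v D : ℕ) : ℕ := ((Finset.range N.n).filter (C.New v D)).card

/-- The code of the set of vertices of `X` that are won by adding `v`. -/
noncomputable def newCode (v D : ℕ) : ℕ := ∑ x ∈ (Finset.range N.n).filter (C.New v D), C.wt x

/-- The number of vertices of the cluster `r` that are not won by `G`. -/
noncomputable def bonus (G : Finset ℕ) (r : ℕ) : ℕ :=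
  ((Finset.range N.n).filter fun u => C.rep u = r ∧ ¬ N.Dominated G u).card

/-- The reason why the code is enough of a state: which vertices of `X` are newly won by `v` can be
read off from `C.code S` without knowing `S`. -/
theorem new_code_iff (S : Finset ℕ) (v : ℕ) {x : ℕ} (hx : x < N.n) :
    C.New v (C.code S) x ↔ C.wt x ≠ 0 ∧ N.adj v x ∧ ¬ N.Dominated S x := by
  unfold New
  refine and_congr_right fun h => and_congr_right fun _ => ?_
  rw [← C.bit_code_iff S hx h, not_not]

theorem code_insert (S : Finset ℕ) (v : ℕ) :
    C.code (insert v S) = C.code S + C.newCode v (C.code S) := by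
  simp only [newCode]
  rw [Finset.filter_congr fun x hx => C.new_code_iff S v (Finset.mem_range.1 hx)]
  simp only [code, Finset.sum_filter, ← Finset.sum_add_distrib]
  refine Finset.sum_congr rfl fun x hx => ?_
  simp only [N.dominated_insert]
  by_cases h1 : N.Dominated S x <;> by_cases h2 : N.adj v x <;> by_cases h3 : C.wt x = 0 <;>
    simp [h1, h2, h3]

/-- The vertices won afterwards are of three disjoint kinds: those won before, those newly won in
`X`, and those newly won in the cluster of `v`. There are no others, because outside `X` adjacency
to `v` means membership in its cluster. -/
theorem count_insert (S : Finset ℕ) (v : ℕ) (hv : v < N.n) (hvX : v ∉ C.X) :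
    N.count (insert v S) = N.count S + C.newCount v (C.code S) +
      ((Finset.range N.n).filter fun u => C.rep u = C.rep v ∧ ¬ N.Dominated S u).card := by
  simp only [newCount]
  rw [Finset.filter_congr fun x hx => C.new_code_iff S v (Finset.mem_range.1 hx)]
  simp only [Net.count, Finset.card_filter, ← Finset.sum_add_distrib]
  refine Finset.sum_congr rfl fun x hx => ?_
  have hx := Finset.mem_range.1 hx
  simp only [N.dominated_insert]
  have hr : C.rep v ≠ 0 := fun h => hvX ((C.rep_eq_zero v hv).1 h)
  by_cases h3 : x ∈ C.X
  · have h4 : C.wt x ≠ 0 := fun h => (C.wt_eq_zero x hx).1 h h3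
    have h5 : C.rep x ≠ C.rep v := by rw [(C.rep_eq_zero x hx).2 h3]; exact hr.symm
    by_cases h1 : N.Dominated S x <;> by_cases h2 : N.adj v x <;> simp [h1, h2, h4, h5]
  · have h4 : C.wt x = 0 := (C.wt_eq_zero x hx).2 h3
    have h5 : N.adj v x ↔ C.rep x = C.rep v := by rw [C.adj_iff v hv x hx hvX h3, eq_comm]
    by_cases h1 : N.Dominated S x <;> by_cases h2 : N.adj v x <;> simp [h1, h2, h4, ← h5]

/-- The vertex `u` of the same clique already wins the whole cluster, so the third term of
`count_insert` vanishes. The case `v ∈ S` is allowed. -/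
theorem count_insert_again (S : Finset ℕ) {u v : ℕ} (hv : v < N.n) (hvX : v ∉ C.X)
    (hu : u < N.n) (huS : u ∈ S) (huv : C.rep u = C.rep v) :
    N.count (insert v S) = N.count S + C.newCount v (C.code S) := by
  rw [C.count_insert S v hv hvX, Finset.filter_false_of_mem, Finset.card_empty, add_zero]
  rintro x hx ⟨h1, h2⟩
  have hx := Finset.mem_range.1 hx
  have hr : C.rep v ≠ 0 := fun h => hvX ((C.rep_eq_zero v hv).1 h)
  refine h2 (Or.inr ⟨u, huS, ?_⟩)
  rw [C.adj_iff u hu x hx, huv, h1]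
  · rw [← C.rep_eq_zero u hu, huv]; exact hr
  · rw [← C.rep_eq_zero x hx, h1]; exact hr

/-- There are no edges between different clusters, so a cluster that has not been reached yet can
only be won from inside `X`, that is, by the guess `G`. -/
theorem dominated_iff_of_rep_ne {S G : Finset ℕ} {r u : ℕ} (hS : S ⊆ Finset.range N.n)
    (hG : S ∩ C.X = G) (hr : ∀ v ∈ S, C.rep v < r) (hu : u < N.n) (hru : C.rep u = r) :
    N.Dominated S u ↔ N.Dominated G u := by
  refine or_congr_right ⟨?_, ?_⟩
  · rintro ⟨w, hw, hwu⟩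
    have hwn := Finset.mem_range.1 (hS hw)
    refine ⟨w, ?_, hwu⟩
    rw [← hG]
    refine Finset.mem_inter.2 ⟨hw, ?_⟩
    by_contra hX
    have huX : u ∉ C.X := by
      rw [← C.rep_eq_zero u hu, hru]
      have := hr w hw
      omega
    have := (C.adj_iff w hwn u hu hX huX).1 hwu
    have := hr w hw
    omega
  · rintro ⟨w, hw, hwu⟩
    exact ⟨w, (Finset.mem_inter.1 (hG ▸ hw)).1, hwu⟩

/-- As the cluster of `v` comes after all clusters met by `S`, its contribution depends on `G` only
and can be computed once per cluster. -/
theorem count_insert_first {S G : Finset ℕ} {v : ℕ} (hS : S ⊆ Finset.range N.n)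
    (hG : S ∩ C.X = G) (hr : ∀ u ∈ S, C.rep u < C.rep v) (hv : v < N.n) (hvX : v ∉ C.X) :
    N.count (insert v S) = N.count S + C.newCount v (C.code S) + C.bonus G (C.rep v) := by
  rw [C.count_insert S v hv hvX, bonus]
  congr 2
  refine Finset.filter_congr fun x hx => and_congr_right fun h => not_congr ?_
  exact C.dominated_iff_of_rep_ne hS hG hr (Finset.mem_range.1 hx) h

/-- Sets that meet `X` in `G` and all other vertices of which are in the clusters `1, …, r`. -/
def Upto (G : Finset ℕ) (r : ℕ) (S : Finset ℕ) : Prop :=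
  S ⊆ Finset.range N.n ∧ S ∩ C.X = G ∧ ∀ v ∈ S, C.rep v ≤ r

/-- Sets as in `Upto G r` that contain a vertex of the cluster `r`, and only such below `w`. -/
def Within (G : Finset ℕ) (r w : ℕ) (S : Finset ℕ) : Prop :=
  C.Upto G r S ∧ (∀ v ∈ S, C.rep v = r → v < w) ∧ ∃ v ∈ S, C.rep v = r

/-- A nonzero table entry is the unspent part of the budget, plus one, for some set. -/
def Sound (A : Finset ℕ → Prop) (T : ℕ → ℕ → ℕ) : Prop :=
  ∀ m ≤ N.n, ∀ D < C.size, T m D ≠ 0 →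
    ∃ S, A S ∧ N.count S = m ∧ C.code S = D ∧ N.total S + T m D ≤ N.budget + 1

/-- The table takes every set into account. -/
def Complete (A : Finset ℕ → Prop) (T : ℕ → ℕ → ℕ) : Prop :=
  ∀ S, A S → N.budget + 1 ≤ T (N.count S) (C.code S) + N.total S

/-! ### Soundness and completeness of the table transitions. -/

variable {C}

theorem Sound.mono {A B : Finset ℕ → Prop} {T : ℕ → ℕ → ℕ} (h : C.Sound A T)
    (hAB : ∀ S, A S → B S) : C.Sound B T := by
  intro m hm D hD hT
  obtain ⟨S, h1, h2⟩ := h m hm D hD hT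
  exact ⟨S, hAB S h1, h2⟩

theorem Sound.update {A : Finset ℕ → Prop} {T T' : ℕ → ℕ → ℕ} (h : C.Sound A T) {a b val : ℕ}
    (hT' : ∀ i j, T' i j = if i = a ∧ j = b then max (T a b) val else T i j)
    (hval : val ≠ 0 → ∃ S, A S ∧ N.count S = a ∧ C.code S = b ∧
      N.total S + val ≤ N.budget + 1) : C.Sound A T' := by
  intro m hm D hD hT
  rw [hT'] at hT ⊢
  split_ifs at hT ⊢ with hab
  · obtain ⟨rfl, rfl⟩ := hab
    rcases max_choice (T m D) val with hc | hc <;> rw [hc] at hT ⊢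
    · exact h m hm D hD hT
    · exact hval hT
  · exact h m hm D hD hT

/-- Buying `v` as the first vertex of cluster `r + 1`. The truncated difference is nonzero exactly
if the price is covered; since entries are shifted by one, spending the budget exactly leaves `1`
and not `0`. -/
theorem sound_first {G : Finset ℕ} {r v m D : ℕ} {T : ℕ → ℕ → ℕ} (hT : C.Sound (C.Upto G r) T)
    (hv : v < N.n) (hr : C.rep v = r + 1) (hm : m ≤ N.n) (hD : D < C.size)
    (h : T m D - N.price v ≠ 0) :
    ∃ S, C.Within G (r + 1) (v + 1) S ∧ N.count S = m + C.newCount v D + C.bonus G (r + 1) ∧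
      C.code S = D + C.newCode v D ∧ N.total S + (T m D - N.price v) ≤ N.budget + 1 := by
  obtain ⟨S, ⟨h1, h2, h3⟩, rfl, rfl, h4⟩ := hT m hm D hD (by omega)
  have hvX : v ∉ C.X := by rw [← C.rep_eq_zero v hv]; omega
  refine ⟨insert v S, ⟨⟨?_, ?_, ?_⟩, ?_, v, by simp, hr⟩, ?_, C.code_insert S v, ?_⟩
  · exact Finset.insert_subset (Finset.mem_range.2 hv) h1
  · rw [Finset.insert_inter_of_notMem hvX, h2]
  · intro u hu
    rcases Finset.mem_insert.1 hu with rfl | hu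
    · omega
    · have := h3 u hu; omega
  · intro u hu hru
    rcases Finset.mem_insert.1 hu with rfl | hu
    · omega
    · have := h3 u hu; omega
  · rw [C.count_insert_first h1 h2 _ hv hvX, hr]
    intro u hu
    have := h3 u hu; omega
  · have := N.total_insert_le S v; omega

theorem sound_again {G : Finset ℕ} {r v m D : ℕ} {F : ℕ → ℕ → ℕ}
    (hF : C.Sound (C.Within G (r + 1) (v + 1)) F)
    (hv : v < N.n) (hr : C.rep v = r + 1) (hm : m ≤ N.n) (hD : D < C.size)
    (h : F m D - N.price v ≠ 0) :
    ∃ S, C.Within G (r + 1) (v + 1) S ∧ N.count S = m + C.newCount v D ∧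
      C.code S = D + C.newCode v D ∧ N.total S + (F m D - N.price v) ≤ N.budget + 1 := by
  obtain ⟨S, ⟨⟨h1, h2, h3⟩, h5, u, hu, hru⟩, rfl, rfl, h4⟩ := hF m hm D hD (by omega)
  have hvX : v ∉ C.X := by rw [← C.rep_eq_zero v hv]; omega
  refine ⟨insert v S, ⟨⟨?_, ?_, ?_⟩, ?_, v, by simp, hr⟩, ?_, C.code_insert S v, ?_⟩
  · exact Finset.insert_subset (Finset.mem_range.2 hv) h1
  · rw [Finset.insert_inter_of_notMem hvX, h2]
  · intro u hu
    rcases Finset.mem_insert.1 hu with rfl | hu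
    · omega
    · have := h3 u hu; omega
  · intro u hu hru
    rcases Finset.mem_insert.1 hu with rfl | hu
    · omega
    · exact h5 u hu hru
  · exact C.count_insert_again S hv hvX (Finset.mem_range.1 (h1 hu)) hu (by omega)
  · have := N.total_insert_le S v; omega

/-- A set that omits `v` is covered by the old table `F`. A set that contains `v` arises by
inserting `v` into a smaller set, which is covered by `F` or by `T` according to whether it already
meets the cluster. Only lower bounds on `F'` are needed, so entries changed meanwhile do no damage.
-/
theorem complete_step {G : Finset ℕ} {r v : ℕ} {T F F' : ℕ → ℕ → ℕ}
    (hT : C.Complete (C.Upto G r) T) (hF : C.Complete (C.Within G (r + 1) v) F)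
    (hv : v < N.n) (hr : C.rep v = r + 1) (hle : ∀ m D, F m D ≤ F' m D)
    (h : ∀ m ≤ N.n, ∀ D < C.size,
      T m D - N.price v ≤
        F' (m + C.newCount v D + C.bonus G (r + 1)) (D + C.newCode v D) ∧
      F m D - N.price v ≤ F' (m + C.newCount v D) (D + C.newCode v D)) :
    C.Complete (C.Within G (r + 1) (v + 1)) F' := by
  rintro S ⟨⟨h1, h2, h3⟩, h4, h5⟩
  have hvX : v ∉ C.X := by rw [← C.rep_eq_zero v hv]; omega
  by_cases hvS : v ∈ S
  · obtain ⟨S', hvS', rfl⟩ : ∃ S', v ∉ S' ∧ insert v S' = S :=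
      ⟨S.erase v, by simp, Finset.insert_erase hvS⟩
    have h1' : S' ⊆ Finset.range N.n := (Finset.subset_insert _ _).trans h1
    have h2' : S' ∩ C.X = G := by rw [← h2, Finset.insert_inter_of_notMem hvX]
    have h3' : ∀ u ∈ S', C.rep u ≤ r + 1 := fun u hu => h3 u (Finset.mem_insert_of_mem hu)
    have htot : N.total (insert v S') = N.price v + N.total S' := Finset.sum_insert hvS'
    obtain ⟨k1, k2⟩ := h (N.count S') (N.count_le S') (C.code S') (C.code_lt_size S')
    rw [← C.code_insert] at k1 k2
    by_cases hu : ∃ u ∈ S', C.rep u = r + 1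
    · obtain ⟨u, hu, hru⟩ := hu
      have := hF S' ⟨⟨h1', h2', h3'⟩, ?_, u, hu, hru⟩
      · rw [← C.count_insert_again S' hv hvX (Finset.mem_range.1 (h1' hu)) hu
          (by omega)] at k2
        omega
      · intro w hw hrw
        have := h4 w (Finset.mem_insert_of_mem hw) hrw
        have : w ≠ v := by rintro rfl; exact hvS' hw
        omega
    · have h3'' : ∀ u ∈ S', C.rep u ≤ r := by
        intro u hu'
        have := h3' u hu'
        have : C.rep u ≠ r + 1 := fun h => hu ⟨u, hu', h⟩
        omega
      have := hT S' ⟨h1', h2', h3''⟩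
      rw [← hr, ← C.count_insert_first h1' h2' _ hv hvX] at k1
      · omega
      · intro u hu
        have := h3'' u hu
        omega
  · refine (hF S ⟨⟨h1, h2, h3⟩, ?_, h5⟩).trans (Nat.add_le_add_right (hle _ _) _)
    intro w hw hrw
    have := h4 w hw hrw
    have : w ≠ v := by rintro rfl; exact hvS hw
    omega

theorem within_succ_of_ne {G S : Finset ℕ} {r v : ℕ} (h : C.rep v ≠ r)
    (hS : C.Within G r (v + 1) S) : C.Within G r v S := by
  refine ⟨hS.1, fun w hw hrw => ?_, hS.2.2⟩
  have := hS.2.1 w hw hrw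
  have : w ≠ v := by rintro rfl; exact h hrw
  omega

theorem within_mono {G S : Finset ℕ} {r v : ℕ}
    (hS : C.Within G r v S) : C.Within G r (v + 1) S :=
  ⟨hS.1, fun w hw hrw => (hS.2.1 w hw hrw).trans (Nat.lt_succ_self v), hS.2.2⟩

/-- The tables `T` and `F` stand for the sets that avoid cluster `r + 1` and those that meet it; for
`w = N.n` the restriction in `Within` to vertices below `w` is void. -/
theorem sound_max {G : Finset ℕ} {r : ℕ} {T F T' : ℕ → ℕ → ℕ}
    (hT : C.Sound (C.Upto G r) T) (hF : C.Sound (C.Within G (r + 1) N.n) F)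
    (hT' : ∀ m ≤ N.n, ∀ D < C.size, T' m D = max (T m D) (F m D)) :
    C.Sound (C.Upto G (r + 1)) T' := by
  intro m hm D hD h
  rw [hT' m hm D hD] at h ⊢
  rcases max_choice (T m D) (F m D) with hc | hc <;> rw [hc] at h ⊢
  · obtain ⟨S, h1, h2⟩ := hT m hm D hD h
    exact ⟨S, ⟨h1.1, h1.2.1, fun v hv => (h1.2.2 v hv).trans (Nat.le_succ r)⟩, h2⟩
  · obtain ⟨S, h1, h2⟩ := hF m hm D hD h
    exact ⟨S, h1.1, h2⟩

theorem complete_max {G : Finset ℕ} {r : ℕ} {T F T' : ℕ → ℕ → ℕ}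
    (hT : C.Complete (C.Upto G r) T) (hF : C.Complete (C.Within G (r + 1) N.n) F)
    (hT' : ∀ m ≤ N.n, ∀ D < C.size, T' m D = max (T m D) (F m D)) :
    C.Complete (C.Upto G (r + 1)) T' := by
  rintro S ⟨h1, h2, h3⟩
  rw [hT' _ (N.count_le S) _ (C.code_lt_size S)]
  by_cases hu : ∃ u ∈ S, C.rep u = r + 1
  · have := hF S ⟨⟨h1, h2, h3⟩, fun v hv _ => Finset.mem_range.1 (h1 hv), hu⟩
    have := le_max_right (T (N.count S) (C.code S)) (F (N.count S) (C.code S))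
    omega
  · have := hT S ⟨h1, h2, fun v hv => ?_⟩
    · have := le_max_left (T (N.count S) (C.code S)) (F (N.count S) (C.code S))
      omega
    · have := h3 v hv
      have : C.rep v ≠ r + 1 := fun h => hu ⟨v, hv, h⟩
      omega

theorem sound_init {G : Finset ℕ} {T : ℕ → ℕ → ℕ} (hGX : G ⊆ C.X)
    (hT : ∀ m ≤ N.n, ∀ D < C.size, T m D =
      if m = N.count G ∧ D = C.code G then N.budget + 1 - N.total G else 0) :
    C.Sound (C.Upto G 0) T := by
  intro m hm D hD h
  rw [hT m hm D hD] at h ⊢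
  split_ifs at h ⊢ with hc
  · refine ⟨G, ⟨hGX.trans C.subset, Finset.inter_eq_left.2 hGX, fun v hv => ?_⟩, hc.1.symm,
      hc.2.symm, by omega⟩
    exact ((C.rep_eq_zero v (Finset.mem_range.1 (C.subset (hGX hv)))).2 (hGX hv)).le
  · exact absurd rfl h

/-- Outside `X` cluster numbers are positive, so `G` is the only set in question. If it is
unaffordable, its entry is `0` and the claim still holds by truncation. -/
theorem complete_init {G : Finset ℕ} {T : ℕ → ℕ → ℕ}
    (hT : ∀ m ≤ N.n, ∀ D < C.size, T m D =
      if m = N.count G ∧ D = C.code G then N.budget + 1 - N.total G else 0) :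
    C.Complete (C.Upto G 0) T := by
  rintro S ⟨h1, h2, h3⟩
  have hS : S = G := by
    rw [← h2, eq_comm, Finset.inter_eq_left]
    intro v hv
    exact (C.rep_eq_zero v (Finset.mem_range.1 (h1 hv))).1 (Nat.le_zero.1 (h3 v hv))
  subst hS
  rw [hT _ (N.count_le S) _ (C.code_lt_size S), if_pos ⟨rfl, rfl⟩]
  omega

/-! ### Guessing the bought part of `X`. -/

variable (C) in
/-- The set encoded by `g`. -/
noncomputable def decode (g : ℕ) : Finset ℕ := C.X.filter fun x => g / C.wt x % 2 ≠ 0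

theorem decode_subset (g : ℕ) : C.decode g ⊆ C.X := Finset.filter_subset _ _

theorem exists_decode {G : Finset ℕ} (hG : G ⊆ C.X) : ∃ g < C.size, C.decode g = G := by
  refine ⟨∑ x ∈ G, C.wt x, C.code_lt G hG, ?_⟩
  ext x
  simp only [decode, Finset.mem_filter]
  constructor
  · rintro ⟨h1, h2⟩
    exact (C.bit_code G hG x h1).1 h2
  · exact fun h => ⟨hG h, (C.bit_code G hG x (hG h)).2 h⟩

/-- Outside `X` the weight is `0` and division by `0` gives `0`, so the bit test alone decides
membership and the program need not test for `X`. -/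
theorem mem_decode {g x : ℕ} (hx : x < N.n) : x ∈ C.decode g ↔ g / C.wt x % 2 ≠ 0 := by
  simp only [decode, Finset.mem_filter, and_iff_right_iff_imp]
  intro h
  by_contra h'
  rw [(C.wt_eq_zero x hx).2 h'] at h
  simp at h

/-- Some affordable set that meets `X` in `G` wins more than half of the vertices. -/
def Wins (C : Clustering N) (G : Finset ℕ) : Prop :=
  ∃ S, C.Upto G N.n S ∧ N.total S ≤ N.budget ∧ N.n < 2 * N.count S

theorem wins_iff {G : Finset ℕ} {T : ℕ → ℕ → ℕ} (hs : C.Sound (C.Upto G N.n) T)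
    (hc : C.Complete (C.Upto G N.n) T) :
    C.Wins G ↔ ∃ m < N.n + 1, ∃ D < C.size, N.n < m + m ∧ T m D ≠ 0 := by
  constructor
  · rintro ⟨S, h1, h2, h3⟩
    refine ⟨N.count S, Nat.lt_succ_of_le (N.count_le S), C.code S, C.code_lt_size S,
      by omega, ?_⟩
    have := hc S h1
    omega
  · rintro ⟨m, hm, D, hD, h1, h2⟩
    obtain ⟨S, h3, rfl, rfl, h4⟩ := hs m (Nat.le_of_lt_succ hm) D hD h2
    exact ⟨S, h3, by omega, by omega⟩

/-- Each `S` belongs to the guess `S ∩ X`, which has a code, and cluster numbers are at most `N.n`,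
so `Upto _ N.n` excludes nothing. -/
theorem isYes_iff (C : Clustering N) : N.IsYes ↔ ∃ g < C.size, C.Wins (C.decode g) := by
  constructor
  · rintro ⟨S, h1, h2⟩
    obtain ⟨g, hg, hgS⟩ := C.exists_decode (Finset.inter_subset_right (s₁ := S) (s₂ := C.X))
    exact ⟨g, hg, S, ⟨h1, hgS.symm, fun v hv => C.rep_le v (Finset.mem_range.1 (h1 hv))⟩, h2⟩
  · rintro ⟨g, -, S, h1, h2⟩
    exact ⟨S, h1.1, h2⟩

end Clustering

open LoopProgram

open scoped Classical

/-! ## The program for the dynamic programming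

Registers: `0` number of voters, `1` preferred candidate, `2` budget, `3` answer, `5` number of
subsets of `X`, `6` successor of the number of voters.
Arrays: `0` domination, `1` ranks, `2` prices, `5` weights, `6` clusters, `7` table,
`8` table for the current cluster, `9` voters won by the chosen part of `X`. -/

/-- The memory holds the network and the clustering. -/
structure Holds {N : Net} (C : Clustering N) (S : Store) : Prop where
  n : S.reg 0 = N.n
  budget : S.reg 2 = N.budget
  size : S.reg 5 = C.size
  bound : S.reg 6 = N.n + 1
  adj : ∀ u < N.n, ∀ v < N.n, S.arr 0 u v ≠ 0 ↔ N.adj u v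
  top : ∀ v < N.n, S.arr 1 v (S.reg 1) = 0 ↔ N.top v
  price : ∀ v < N.n, S.arr 2 v 0 = N.price v
  wt : ∀ v < N.n, S.arr 5 v 0 = C.wt v
  rep : ∀ v < N.n, S.arr 6 v 0 = C.rep v

/-- The program leaves the network and the clustering alone. -/
def LoopProgram.preserves (p : LoopProgram) : Bool :=
  [0, 1, 2, 5, 6].all fun y => !p.writesReg y && !p.writesArr y

section

variable {N : Net} {C : Clustering N} {S S' : Store}

theorem Holds.of_frame {p : LoopProgram} (h : Holds C S) (hf : p.Frame S S')
    (hp : p.preserves = true) : Holds C S' := by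
  simp only [preserves, List.all_cons, List.all_nil, Bool.and_true, Bool.and_eq_true,
    Bool.not_eq_true'] at hp
  obtain ⟨⟨r0, a0⟩, ⟨r1, a1⟩, ⟨r2, a2⟩, ⟨r5, a5⟩, r6, a6⟩ := hp
  constructor
  · rw [hf.reg 0 r0, h.n]
  · rw [hf.reg 2 r2, h.budget]
  · rw [hf.reg 5 r5, h.size]
  · rw [hf.reg 6 r6, h.bound]
  · rw [hf.arr 0 a0]; exact h.adj
  · rw [hf.arr 1 a1, hf.reg 1 r1]; exact h.top
  · rw [hf.arr 2 a2]; exact h.price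
  · rw [hf.arr 5 a5]; exact h.wt
  · rw [hf.arr 6 a6]; exact h.rep

/-- The number `x` is the truth value of `P`. -/
def IsFlag (x : ℕ) (P : Prop) : Prop := (P ∧ x = 1) ∨ (¬ P ∧ x = 0)

theorem IsFlag.congr {x : ℕ} {P Q : Prop} (h : IsFlag x P) (hPQ : P ↔ Q) : IsFlag x Q := by
  rwa [IsFlag, ← hPQ]

/-- Fill the table `a`. -/
def fill (a : ℕ) (e : Expr) : LoopProgram :=
  .loop 16 6 (.loop 17 5 (.setArr a (.reg 16) (.reg 17) e))

/-- The premise on `S'` in `he` says that the current cell has not been overwritten yet. It is what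
allows `e` to refer to the old entry of the same table, as in the final maximum of `addCluster`. -/
theorem run_fill {a : ℕ} {e : Expr} (f : ℕ → ℕ → ℕ)
    (he : ∀ S' : Store, (fill a e).Frame S S' →
      S'.arr a (S'.reg 16) (S'.reg 17) = S.arr a (S'.reg 16) (S'.reg 17) →
      e.eval S' = f (S'.reg 16) (S'.reg 17)) :
    ∀ m < S.reg 6, ∀ D < S.reg 5, ((fill a e).run S).arr a m D = f m D := by
  refine loop_rule (P := fun S' => ∀ m < S.reg 6, ∀ D < S.reg 5, S'.arr a m D = f m D)
    (fun i S' => ∀ m D, S'.arr a m D = if m < i ∧ D < S.reg 5 then f m D else S.arr a m D)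
    (by simp) ?_ fun S' _ h m hm D hD => by rw [h, if_pos ⟨hm, hD⟩]
  intro i hi S₁ hf₁ hx₁ hI
  have hQ : S₁.reg 5 = S.reg 5 := hf₁.reg 5 rfl
  refine loop_rule (P := fun S' => ∀ m D, (S'.setReg 16 (i + 1)).arr a m D =
      if m < i + 1 ∧ D < S.reg 5 then f m D else S.arr a m D)
    (fun j S' => ∀ m D, S'.arr a m D =
      if (m < i ∧ D < S.reg 5) ∨ (m = i ∧ D < j) then f m D else S.arr a m D)
    (by simpa using hI) ?_ fun S' _ h m D => ?_
  swap
  · rw [Store.setReg_arr, h, hQ]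
    refine if_congr ?_ rfl rfl
    omega
  intro j hj S₂ hf₂ hx₂ hI₂ m D
  have h16 : S₂.reg 16 = i := by rw [hf₂.reg 16 rfl, hx₁]
  have hev := he S₂ (hf₁.trans (hf₂.loop 16 6)) (by rw [hI₂, h16, hx₂, if_neg (by omega)])
  simp only [run, Store.setReg_arr, Store.setArr_arr, Expr.eval, true_and, h16, hx₂, hI₂]
  rw [h16, hx₂] at hev
  by_cases h : m = i ∧ D = j
  · rw [if_pos h, if_pos (by omega), h.1, h.2, hev]
  · rw [if_neg h]
    refine if_congr ?_ rfl rfl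
    omega

/-- The bit of the code in register `d` that belongs to the vertex in register `18`. -/
def bit (d : ℕ) : Expr := .mod (.div (.reg d) (.arr 5 (.reg 18) (.lit 0))) (.lit 2)

/-- The number and the code of the vertices won after adding the vertex in register `15`. -/
def extend : LoopProgram :=
  .setReg 25 (.reg 16) ;; .setReg 26 (.reg 17) ;;
  .loop 18 0 (when (.and (.arr 5 (.reg 18) (.lit 0))
      (.and (.arr 0 (.reg 15) (.reg 18)) (.not (bit 17))))
    (.setReg 25 (.add (.reg 25) (.lit 1)) ;;
      .setReg 26 (.add (.reg 26) (.arr 5 (.reg 18) (.lit 0)))))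

theorem run_extend (h : Holds C S) (hv : S.reg 15 < N.n) :
    (extend.run S).reg 25 = S.reg 16 + C.newCount (S.reg 15) (S.reg 17) ∧
      (extend.run S).reg 26 = S.reg 17 + C.newCode (S.reg 15) (S.reg 17) := by
  simp only [extend, run]
  set S₁ := (S.setReg 25 (Expr.eval S (.reg 16))).setReg 26
    (Expr.eval (S.setReg 25 (Expr.eval S (.reg 16))) (.reg 17)) with hS₁
  have h₁ : Holds C S₁ := h.of_frame
    (frame_run (.setReg 25 (.reg 16) ;; .setReg 26 (.reg 17)) S) rfl
  refine loop_rule (P := fun S' => S'.reg 25 = S.reg 16 + C.newCount (S.reg 15) (S.reg 17) ∧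
      S'.reg 26 = S.reg 17 + C.newCode (S.reg 15) (S.reg 17))
    (fun i S' => S'.reg 25 = S.reg 16 +
        ((Finset.range i).filter (C.New (S.reg 15) (S.reg 17))).card ∧
      S'.reg 26 = S.reg 17 +
        ∑ x ∈ (Finset.range i).filter (C.New (S.reg 15) (S.reg 17)), C.wt x)
    (by simp [hS₁, Expr.eval]) ?_ fun S' _ hI => by rw [h₁.n] at hI; exact hI
  rintro i hi S' hf hx ⟨h25, h26⟩
  have h' : Holds C S' := h₁.of_frame hf rfl
  have h15 : S'.reg 15 = S.reg 15 := by rw [hf.reg 15 rfl]; simp [hS₁]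
  have h17 : S'.reg 17 = S.reg 17 := by rw [hf.reg 17 rfl]; simp [hS₁]
  rw [h₁.n] at hi
  have hc : (Expr.and (.arr 5 (.reg 18) (.lit 0))
      (.and (.arr 0 (.reg 15) (.reg 18)) (.not (bit 17)))).eval S' ≠ 0 ↔
      C.New (S.reg 15) (S.reg 17) i := by
    rw [Expr.eval_and, Expr.eval_and, Expr.eval_not]
    simp only [bit, Expr.eval, hx, h15, h17, h'.wt i hi, h'.adj _ hv i hi]
    rfl
  simp only [when, run, hc, Finset.range_add_one, Finset.filter_insert]
  by_cases hn : C.New (S.reg 15) (S.reg 17) i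
  · simp [hn, h25, h26, Expr.eval, hx, h'.wt i hi]
    omega
  · simp [hn, h25, h26]

/-- Enter the sets that contain the vertex in register `15`, and otherwise belong to the entries in
position given by registers `16` and `17`, into the table of its cluster. -/
def relax : LoopProgram :=
  extend ;;
  .setArr 8 (.add (.reg 25) (.reg 24)) (.reg 26)
    (.max (.arr 8 (.add (.reg 25) (.reg 24)) (.reg 26))
      (.sub (.arr 7 (.reg 16) (.reg 17)) (.arr 2 (.reg 15) (.lit 0)))) ;;
  .setArr 8 (.reg 25) (.reg 26)
    (.max (.arr 8 (.reg 25) (.reg 26))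
      (.sub (.arr 8 (.reg 16) (.reg 17)) (.arr 2 (.reg 15) (.lit 0))))

theorem run_relax (h : Holds C S) {G : Finset ℕ} {r v m D : ℕ} (h15 : S.reg 15 = v)
    (hv : v < N.n) (hr : C.rep v = r + 1) (h24 : S.reg 24 = C.bonus G (r + 1))
    (h16 : S.reg 16 = m) (hm : m ≤ N.n) (h17 : S.reg 17 = D) (hD : D < C.size)
    (hT : C.Sound (C.Upto G r) (S.arr 7))
    (hF : C.Sound (C.Within G (r + 1) (v + 1)) (S.arr 8)) :
    C.Sound (C.Within G (r + 1) (v + 1)) ((relax.run S).arr 8) ∧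
      (∀ i j, S.arr 8 i j ≤ (relax.run S).arr 8 i j) ∧
      S.arr 7 m D - N.price v ≤ (relax.run S).arr 8
        (m + C.newCount v D + C.bonus G (r + 1)) (D + C.newCode v D) ∧
      S.arr 8 m D - N.price v ≤ (relax.run S).arr 8
        (m + C.newCount v D) (D + C.newCode v D) := by
  obtain ⟨e25, e26⟩ := run_extend h (by omega)
  have hf := frame_run extend S
  have e15 : (extend.run S).reg 15 = v := by rw [hf.reg 15 rfl, h15]
  have e16 : (extend.run S).reg 16 = m := by rw [hf.reg 16 rfl, h16]
  have e17 : (extend.run S).reg 17 = D := by rw [hf.reg 17 rfl, h17]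
  have e24 : (extend.run S).reg 24 = C.bonus G (r + 1) := by rw [hf.reg 24 rfl, h24]
  have e7 : (extend.run S).arr 7 = S.arr 7 := hf.arr 7 rfl
  have e8 : (extend.run S).arr 8 = S.arr 8 := hf.arr 8 rfl
  have ep : (extend.run S).arr 2 v 0 = N.price v := by rw [hf.arr 2 rfl, h.price v hv]
  rw [h15, h16, h17] at e25
  rw [h15, h17] at e26
  set a := m + C.newCount v D with ha
  set b := D + C.newCode v D with hb
  -- The table between the two assignments. The second assignment reads `F₁`, which may already hold
  -- sets containing `v`; these are sound as well.
  obtain ⟨F₁, hF₁⟩ : ∃ F₁ : ℕ → ℕ → ℕ, ∀ i j, F₁ i j =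
      if i = a + C.bonus G (r + 1) ∧ j = b then
        max (S.arr 8 (a + C.bonus G (r + 1)) b) (S.arr 7 m D - N.price v) else S.arr 8 i j :=
    ⟨_, fun _ _ => rfl⟩
  have hF₂ : ∀ i j, (relax.run S).arr 8 i j =
      if i = a ∧ j = b then max (F₁ a b) (F₁ m D - N.price v) else F₁ i j := by
    intro i j
    simp only [relax, run, Store.setArr_arr, Store.setArr_reg, Expr.eval, Expr.eval_max, e25, e26,
      e15, e16, e17, e24, e7, e8, ep, true_and, hF₁]
    simp
  have s₁ : C.Sound (C.Within G (r + 1) (v + 1)) F₁ :=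
    hF.update hF₁ fun h => Clustering.sound_first hT hv hr hm hD h
  have s₂ := s₁.update hF₂ fun h => Clustering.sound_again s₁ hv hr hm hD h
  have l₁ : ∀ i j, S.arr 8 i j ≤ F₁ i j := by
    intro i j
    rw [hF₁]
    split_ifs with hij
    · rw [hij.1, hij.2]; exact le_max_left _ _
    · exact le_rfl
  have l₂ : ∀ i j, F₁ i j ≤ (relax.run S).arr 8 i j := by
    intro i j
    rw [hF₂]
    split_ifs with hij
    · rw [hij.1, hij.2]; exact le_max_left _ _
    · exact le_rfl
  refine ⟨s₂, fun i j => (l₁ i j).trans (l₂ i j), le_trans ?_ (l₂ _ _), ?_⟩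
  · rw [hF₁, if_pos ⟨rfl, rfl⟩]; exact le_max_right _ _
  · rw [hF₂, if_pos ⟨rfl, rfl⟩]
    exact (Nat.sub_le_sub_right (l₁ m D) _).trans (le_max_right _ _)

/-- Enter the sets that contain the vertex in register `15` into the table of its cluster. -/
def addVertex : LoopProgram := .loop 16 6 (.loop 17 5 relax)

theorem run_addVertex (h : Holds C S) {G : Finset ℕ} {r v : ℕ} (h15 : S.reg 15 = v)
    (hv : v < N.n) (hr : C.rep v = r + 1) (h24 : S.reg 24 = C.bonus G (r + 1))
    (hT : C.Sound (C.Upto G r) (S.arr 7)) (hT' : C.Complete (C.Upto G r) (S.arr 7))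
    (hF : C.Sound (C.Within G (r + 1) v) (S.arr 8))
    (hF' : C.Complete (C.Within G (r + 1) v) (S.arr 8)) :
    C.Sound (C.Within G (r + 1) (v + 1)) ((addVertex.run S).arr 8) ∧
      C.Complete (C.Within G (r + 1) (v + 1)) ((addVertex.run S).arr 8) := by
  -- The update is in place, so the table in the middle of the loops has no simple closed form.
  -- Instead it is kept sound and only grows, and the inequalities `R` established for an entry
  -- persist. They refer to the table as it was before `v`.
  let Inv : Store → Prop := fun S' =>
    C.Sound (C.Within G (r + 1) (v + 1)) (S'.arr 8) ∧ ∀ i j, S.arr 8 i j ≤ S'.arr 8 i j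
  let le : Store → Store → Prop := fun S₁ S₂ => ∀ i j, S₁.arr 8 i j ≤ S₂.arr 8 i j
  let R : ℕ → ℕ → Store → Prop := fun m D S' =>
    S.arr 7 m D - N.price v ≤
      S'.arr 8 (m + C.newCount v D + C.bonus G (r + 1)) (D + C.newCode v D) ∧
    S.arr 8 m D - N.price v ≤ S'.arr 8 (m + C.newCount v D) (D + C.newCode v D)
  have htrans : ∀ S₁ S₂ S₃, le S₁ S₂ → le S₂ S₃ → le S₁ S₃ :=
    fun S₁ S₂ S₃ h₁ h₂ i j => (h₁ i j).trans (h₂ i j)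
  have hR : ∀ m D S₁ S₂, le S₁ S₂ → R m D S₁ → R m D S₂ :=
    fun m D S₁ S₂ h₁ h₂ => ⟨h₂.1.trans (h₁ _ _), h₂.2.trans (h₁ _ _)⟩
  have hle : ∀ (S : Store) (x w : ℕ), le S (S.setReg x w) := fun S x w i j => le_rfl
  have hInv : ∀ (S : Store) (x w : ℕ), Inv S → Inv (S.setReg x w) := fun S x w h => h
  have key := loop_collect (S := S) (x := 16) (b := 6) (p := .loop 17 5 relax)
    Inv le (fun m S' => ∀ D < C.size, R m D S') htrans
    (fun m S₁ S₂ h₁ h₂ D hD => hR m D S₁ S₂ h₁ (h₂ D hD)) (fun S => hle S _) (fun S => hInv S _)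
    ⟨hF.mono fun _ => Clustering.within_mono, fun i j => le_rfl⟩ ?_
  · obtain ⟨⟨k₁, k₂⟩, -, k₃⟩ := key
    rw [h.bound] at k₃
    exact ⟨k₁, Clustering.complete_step hT' hF' hv hr k₂
      fun m hm D hD => k₃ m (Nat.lt_succ_of_le hm) D hD⟩
  intro m hm S₁ hf₁ h16 hI
  have h₁ : Holds C S₁ := h.of_frame hf₁ rfl
  have key := loop_collect (S := S₁) (x := 17) (b := 5) (p := relax) Inv le (R m) htrans
    (hR m) (fun S => hle S _) (fun S => hInv S _) hI ?_
  · rw [h₁.size] at key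
    exact key
  intro D hD S₂ hf₂ h17 hI₂
  have hf : (addVertex).Frame S S₂ := hf₁.trans (hf₂.loop 16 6)
  have h₂ : Holds C S₂ := h.of_frame hf rfl
  have e7 : S₂.arr 7 = S.arr 7 := hf.arr 7 rfl
  rw [h.bound] at hm
  rw [h₁.size] at hD
  obtain ⟨k₁, k₂, k₃, k₄⟩ := run_relax h₂ (G := G) (by rw [hf.reg 15 rfl, h15]) hv hr
    (by rw [hf.reg 24 rfl, h24]) (by rw [hf₂.reg 16 rfl, h16]) (Nat.le_of_lt_succ hm) h17 hD
    (by rw [e7]; exact hT) hI₂.1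
  rw [e7] at k₃
  exact ⟨⟨k₁, fun i j => (hI₂.2 i j).trans (k₂ i j)⟩, k₂, k₃,
    (Nat.sub_le_sub_right (hI₂.2 m D) _).trans k₄⟩

/-- Count the vertices of the cluster after the number in register `14` that are not yet won. -/
def countBonus : LoopProgram :=
  .setReg 24 (.lit 0) ;;
  .loop 15 0 (when (.and (.eq (.arr 6 (.reg 15) (.lit 0)) (.add (.reg 14) (.lit 1)))
    (.not (.arr 9 (.reg 15) (.lit 0)))) (.setReg 24 (.add (.reg 24) (.lit 1))))

theorem run_countBonus (h : Holds C S) {G : Finset ℕ} {r : ℕ} (h14 : S.reg 14 = r)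
    (h9 : ∀ v < N.n, S.arr 9 v 0 ≠ 0 ↔ N.Dominated G v) :
    (countBonus.run S).reg 24 = C.bonus G (r + 1) := by
  have h₁ : Holds C (S.setReg 24 0) := h.of_frame (frame_run (.setReg 24 (.lit 0)) S) rfl
  refine loop_rule (S := S.setReg 24 0) (P := fun S' => S'.reg 24 = C.bonus G (r + 1))
    (fun i S' => S'.reg 24 = ((Finset.range i).filter fun u =>
      C.rep u = r + 1 ∧ ¬ N.Dominated G u).card) (by simp) ?_
    fun S' _ hI => by rw [h₁.n] at hI; exact hI
  intro i hi S' hf hx hI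
  rw [h₁.n] at hi
  have h' : Holds C S' := h₁.of_frame hf rfl
  have e14 : S'.reg 14 = r := by rw [hf.reg 14 rfl]; simp [h14]
  have e9 : S'.arr 9 i 0 = S.arr 9 i 0 := by rw [hf.arr 9 rfl]; rfl
  have hc : (Expr.and (.eq (.arr 6 (.reg 15) (.lit 0)) (.add (.reg 14) (.lit 1)))
      (.not (.arr 9 (.reg 15) (.lit 0)))).eval S' ≠ 0 ↔
      C.rep i = r + 1 ∧ ¬ N.Dominated G i := by
    rw [Expr.eval_and, Expr.eval_not, Expr.eval_eq]
    simp only [Expr.eval, hx, e14, h'.rep i hi, e9, ← h9 i hi, not_not]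
  simp only [when, run, hc, Finset.range_add_one, Finset.filter_insert]
  by_cases hn : C.rep i = r + 1 ∧ ¬ N.Dominated G i
  · simp [hn, hI, Expr.eval]
  · simp [hn, hI]

/-- Process the vertices of a cluster. -/
def addVertices : LoopProgram :=
  .loop 15 0 (when (.eq (.arr 6 (.reg 15) (.lit 0)) (.add (.reg 14) (.lit 1))) addVertex)

theorem run_addVertices (h : Holds C S) {G : Finset ℕ} {r : ℕ} (h14 : S.reg 14 = r)
    (h24 : S.reg 24 = C.bonus G (r + 1))
    (hT : C.Sound (C.Upto G r) (S.arr 7)) (hT' : C.Complete (C.Upto G r) (S.arr 7))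
    (hF : ∀ m < N.n + 1, ∀ D < C.size, S.arr 8 m D = 0) :
    C.Sound (C.Within G (r + 1) N.n) ((addVertices.run S).arr 8) ∧
      C.Complete (C.Within G (r + 1) N.n) ((addVertices.run S).arr 8) := by
  refine loop_rule (P := fun S' => C.Sound (C.Within G (r + 1) N.n) (S'.arr 8) ∧
      C.Complete (C.Within G (r + 1) N.n) (S'.arr 8))
    (fun v S' => C.Sound (C.Within G (r + 1) v) (S'.arr 8) ∧
      C.Complete (C.Within G (r + 1) v) (S'.arr 8)) ?_ ?_
    fun S' _ hI => by rw [h.n] at hI; exact hI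
  -- No vertex lies below `0`, so no set is to be taken into account and the zero table is complete.
  · refine ⟨fun m hm D hD hne => absurd (hF m (Nat.lt_succ_of_le hm) D hD) hne, ?_⟩
    rintro A ⟨-, h1, v, hv, hrv⟩
    exact absurd (h1 v hv hrv) (Nat.not_lt_zero v)
  rintro v hv S' hf h15 ⟨hI, hI'⟩
  rw [h.n] at hv
  have h' : Holds C S' := h.of_frame hf rfl
  have e14 : S'.reg 14 = r := by rw [hf.reg 14 rfl, h14]
  have e7 : S'.arr 7 = S.arr 7 := hf.arr 7 rfl
  have hc : (Expr.eq (.arr 6 (.reg 15) (.lit 0)) (.add (.reg 14) (.lit 1))).eval S' ≠ 0 ↔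
      C.rep v = r + 1 := by
    rw [Expr.eval_eq]
    simp only [Expr.eval, h15, e14, h'.rep v hv]
  simp only [when, run, hc, Store.setReg_arr]
  split_ifs with hr
  · exact run_addVertex h' h15 hv hr (by rw [hf.reg 24 rfl, h24]) (by rw [e7]; exact hT)
      (by rw [e7]; exact hT') hI hI'
  · exact ⟨hI.mono fun _ => Clustering.within_mono,
      fun A hA => hI' A (Clustering.within_succ_of_ne hr hA)⟩

/-- Process the cluster after the number in register `14`. -/
def addCluster : LoopProgram :=
  fill 8 (.lit 0) ;; countBonus ;; addVertices ;;
    fill 7 (.max (.arr 7 (.reg 16) (.reg 17)) (.arr 8 (.reg 16) (.reg 17)))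

theorem run_addCluster (h : Holds C S) {G : Finset ℕ} {r : ℕ} (h14 : S.reg 14 = r)
    (h9 : ∀ v < N.n, S.arr 9 v 0 ≠ 0 ↔ N.Dominated G v)
    (hT : C.Sound (C.Upto G r) (S.arr 7)) (hT' : C.Complete (C.Upto G r) (S.arr 7)) :
    C.Sound (C.Upto G (r + 1)) ((addCluster.run S).arr 7) ∧
      C.Complete (C.Upto G (r + 1)) ((addCluster.run S).arr 7) := by
  simp only [addCluster, run]
  have k₁ := run_fill (S := S) (a := 8) (e := .lit 0) (fun _ _ => 0) (fun _ _ _ => rfl)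
  rw [h.bound, h.size] at k₁
  have f₁ := frame_run (fill 8 (.lit 0)) S
  generalize (fill 8 (.lit 0)).run S = S₁ at *
  have h₁ : Holds C S₁ := h.of_frame f₁ rfl
  have k₂ := run_countBonus h₁ (G := G) (r := r) (by rw [f₁.reg 14 rfl, h14])
    (by rw [f₁.arr 9 rfl]; exact h9)
  have f₂ := frame_run countBonus S₁
  generalize countBonus.run S₁ = S₂ at *
  have h₂ : Holds C S₂ := h₁.of_frame f₂ rfl
  have e7 : S₂.arr 7 = S.arr 7 := by rw [f₂.arr 7 rfl, f₁.arr 7 rfl]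
  have k₃ := run_addVertices h₂ (by rw [f₂.reg 14 rfl, f₁.reg 14 rfl, h14]) k₂
    (by rw [e7]; exact hT) (by rw [e7]; exact hT') (by rw [f₂.arr 8 rfl]; exact k₁)
  have f₃ := frame_run addVertices S₂
  generalize addVertices.run S₂ = S₃ at *
  have h₃ : Holds C S₃ := h₂.of_frame f₃ rfl
  have k₄ := run_fill (S := S₃) (a := 7)
    (e := .max (.arr 7 (.reg 16) (.reg 17)) (.arr 8 (.reg 16) (.reg 17)))
    (fun m D => max (S.arr 7 m D) (S₃.arr 8 m D)) fun S' hf he => by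
      rw [Expr.eval_max]
      simp only [Expr.eval, he, hf.arr 8 rfl, f₃.arr 7 rfl, e7]
  rw [h₃.bound, h₃.size] at k₄
  have k₅ : ∀ m ≤ N.n, ∀ D < C.size, _ := fun m hm D hD => k₄ m (Nat.lt_succ_of_le hm) D hD
  exact ⟨Clustering.sound_max hT k₃.1 k₅, Clustering.complete_max hT' k₃.2 k₅⟩

/-- Compute the part of the budget, plus one, that the set encoded in register `13` leaves. -/
def payChosen : LoopProgram :=
  .setReg 20 (.add (.reg 2) (.lit 1)) ;;
  .loop 18 0 (when (bit 13) (.setReg 20 (.sub (.reg 20) (.arr 2 (.reg 18) (.lit 0)))))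

theorem Holds.eval_bit (h : Holds C S) {g x d : ℕ} (hd : S.reg d = g) (h18 : S.reg 18 = x)
    (hx : x < N.n) : (bit d).eval S ≠ 0 ↔ x ∈ C.decode g := by
  rw [Clustering.mem_decode hx]
  simp only [bit, Expr.eval, hd, h18, h.wt x hx]

theorem run_payChosen (h : Holds C S) {g : ℕ} (h13 : S.reg 13 = g) :
    (payChosen.run S).reg 20 = N.budget + 1 - N.total (C.decode g) := by
  have h₁ : Holds C (S.setReg 20 (N.budget + 1)) := by
    rw [← h.budget]
    exact h.of_frame (frame_run (.setReg 20 (.add (.reg 2) (.lit 1))) S) rfl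
  simp only [payChosen, run, Expr.eval, h.budget]
  refine loop_rule (S := S.setReg 20 (N.budget + 1))
    (P := fun S' => S'.reg 20 = N.budget + 1 - N.total (C.decode g))
    (fun i S' => S'.reg 20 = N.budget + 1 -
      ∑ x ∈ (Finset.range i).filter (· ∈ C.decode g), N.price x) (by simp) ?_ fun S' _ hI => ?_
  · intro i hi S' hf hx hI
    rw [h₁.n] at hi
    have h' : Holds C S' := h₁.of_frame hf rfl
    have hc := h'.eval_bit (d := 13) (g := g) (by rw [hf.reg 13 rfl]; simp [h13]) hx hi
    simp only [when, run, hc, Finset.range_add_one, Finset.filter_insert]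
    by_cases hn : i ∈ C.decode g
    · simp [hn, hI, Expr.eval, hx, h'.price i hi]
      omega
    · simp [hn, hI]
  · rw [hI, h₁.n, Finset.filter_mem_eq_inter, Finset.inter_eq_right.2]
    · rfl
    · exact (Clustering.decode_subset g).trans C.subset

/-- Whether the vertex in register `15` is won by the set encoded in register `13`. -/
def winVertex : LoopProgram :=
  .setArr 9 (.reg 15) (.lit 0) (.not (.arr 1 (.reg 15) (.reg 1))) ;;
  .loop 18 0 (when (.and (bit 13) (.arr 0 (.reg 18) (.reg 15)))
    (.setArr 9 (.reg 15) (.lit 0) (.lit 1)))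

theorem run_winVertex (h : Holds C S) {g v : ℕ} (h13 : S.reg 13 = g) (h15 : S.reg 15 = v)
    (hv : v < N.n) :
    ((winVertex.run S).arr 9 v 0 ≠ 0 ↔ N.Dominated (C.decode g) v) ∧
      ∀ u ≠ v, (winVertex.run S).arr 9 u 0 = S.arr 9 u 0 := by
  simp only [winVertex, run]
  set S₁ := S.setArr 9 (Expr.eval S (.reg 15)) (Expr.eval S (.lit 0))
    (Expr.eval S (.not (.arr 1 (.reg 15) (.reg 1)))) with hS₁
  have f₁ := frame_run (.setArr 9 (.reg 15) (.lit 0) (.not (.arr 1 (.reg 15) (.reg 1)))) S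
  have h₁ : Holds C S₁ := h.of_frame f₁ rfl
  refine loop_rule (S := S₁) (P := fun S' => (S'.arr 9 v 0 ≠ 0 ↔ N.Dominated (C.decode g) v) ∧
      ∀ u ≠ v, S'.arr 9 u 0 = S.arr 9 u 0)
    (fun i S' => (S'.arr 9 v 0 ≠ 0 ↔ N.top v ∨ ∃ u < i, u ∈ C.decode g ∧ N.adj u v) ∧
      ∀ u ≠ v, S'.arr 9 u 0 = S.arr 9 u 0) ?_ ?_ ?_
  · have hev : S₁.arr 9 v 0 ≠ 0 ↔ N.top v := by
      rw [← h.top v hv]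
      simp only [hS₁, Store.setArr_arr, Expr.eval, h15, if_true, and_self]
      rw [show (Expr.not (.arr 1 (.reg 15) (.reg 1))).eval S ≠ 0 ↔ _ from Expr.eval_not]
      simp [Expr.eval, h15]
    refine ⟨by simpa using hev, fun u hu => ?_⟩
    simp [hS₁, Expr.eval, h15, hu]
  · rintro i hi S' hf hx ⟨hI, hI'⟩
    rw [h₁.n] at hi
    have h' : Holds C S' := h₁.of_frame hf rfl
    have e13 : S'.reg 13 = g := by rw [hf.reg 13 rfl, ← h13]; rfl
    have e15 : S'.reg 15 = v := by rw [hf.reg 15 rfl, ← h15]; rfl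
    have hc : (Expr.and (bit 13) (.arr 0 (.reg 18) (.reg 15))).eval S' ≠ 0 ↔
        i ∈ C.decode g ∧ N.adj i v := by
      rw [Expr.eval_and, h'.eval_bit e13 hx hi]
      simp only [Expr.eval, hx, e15, h'.adj i hi v hv]
    have hex : (∃ u < i + 1, u ∈ C.decode g ∧ N.adj u v) ↔
        (∃ u < i, u ∈ C.decode g ∧ N.adj u v) ∨ (i ∈ C.decode g ∧ N.adj i v) := by
      simp only [Nat.lt_succ_iff_lt_or_eq, or_and_right, exists_or, exists_eq_left]
    simp only [when, run, hc, hex]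
    by_cases hn : i ∈ C.decode g ∧ N.adj i v
    · rw [if_pos hn]
      refine ⟨by simp [Expr.eval, e15, hn], fun u hu => ?_⟩
      simp [Expr.eval, e15, hu, hI' u hu]
    · rw [if_neg hn]
      refine ⟨by simpa [hn] using hI, hI'⟩
  · rintro S' - ⟨hI, hI'⟩
    refine ⟨hI.trans (or_congr_right ?_), hI'⟩
    rw [h₁.n]
    exact exists_congr fun u => ⟨fun hu => hu.2, fun hu =>
      ⟨Finset.mem_range.1 (C.subset (Clustering.decode_subset g hu.1)), hu⟩⟩

/-- Which vertices are won by the set encoded in register `13`, how many, and the code of those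
in `X`. -/
def winVertices : LoopProgram :=
  .setReg 21 (.lit 0) ;; .setReg 22 (.lit 0) ;;
  .loop 15 0 (winVertex ;; when (.arr 9 (.reg 15) (.lit 0))
    (.setReg 21 (.add (.reg 21) (.lit 1)) ;;
      .setReg 22 (.add (.reg 22) (.arr 5 (.reg 15) (.lit 0)))))

theorem run_winVertices (h : Holds C S) {g : ℕ} (h13 : S.reg 13 = g) :
    (∀ v < N.n, (winVertices.run S).arr 9 v 0 ≠ 0 ↔ N.Dominated (C.decode g) v) ∧
      (winVertices.run S).reg 21 = N.count (C.decode g) ∧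
      (winVertices.run S).reg 22 = C.code (C.decode g) := by
  simp only [winVertices, run_seq, run_setReg, Expr.eval]
  set S₁ := (S.setReg 21 0).setReg 22 0 with hS₁
  have h₁ : Holds C S₁ :=
    h.of_frame (frame_run (.setReg 21 (.lit 0) ;; .setReg 22 (.lit 0)) S) rfl
  refine loop_rule (S := S₁)
    (P := fun S' => (∀ v < N.n, S'.arr 9 v 0 ≠ 0 ↔ N.Dominated (C.decode g) v) ∧
      S'.reg 21 = N.count (C.decode g) ∧ S'.reg 22 = C.code (C.decode g))
    (fun i S' => (∀ v < i, S'.arr 9 v 0 ≠ 0 ↔ N.Dominated (C.decode g) v) ∧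
      S'.reg 21 = ((Finset.range i).filter (N.Dominated (C.decode g))).card ∧
      S'.reg 22 = ∑ x ∈ (Finset.range i).filter (N.Dominated (C.decode g)), C.wt x)
    (by simp [hS₁]) ?_ fun S' _ hI => by rw [h₁.n] at hI; exact hI
  rintro i hi S' hf hx ⟨hI₁, hI₂, hI₃⟩
  rw [h₁.n] at hi
  have h' : Holds C S' := h₁.of_frame hf rfl
  have e13 : S'.reg 13 = g := by rw [hf.reg 13 rfl]; simp [hS₁, h13]
  obtain ⟨k₁, k₂⟩ := run_winVertex h' e13 hx hi
  have f₂ := frame_run winVertex S'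
  simp only [run]
  generalize winVertex.run S' = S₂ at *
  have h₂ : Holds C S₂ := h'.of_frame f₂ rfl
  have e15 : S₂.reg 15 = i := by rw [f₂.reg 15 rfl, hx]
  have e21 := f₂.reg 21 rfl
  have e22 := f₂.reg 22 rfl
  have hc : (Expr.arr 9 (.reg 15) (.lit 0)).eval S₂ ≠ 0 ↔ N.Dominated (C.decode g) i := by
    simp only [Expr.eval, e15, k₁]
  have k₃ : ∀ v < i + 1, S₂.arr 9 v 0 ≠ 0 ↔ N.Dominated (C.decode g) v := by
    intro v hv
    rcases Nat.lt_succ_iff_lt_or_eq.1 hv with hv | rfl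
    · rw [k₂ v hv.ne, hI₁ v hv]
    · exact k₁
  simp only [when, run, hc, Finset.range_add_one, Finset.filter_insert]
  by_cases hn : N.Dominated (C.decode g) i
  · simp only [if_pos hn]
    refine ⟨k₃, ?_, ?_⟩
    · simp [e21, hI₂, Expr.eval]
    · simp [e22, hI₃, Expr.eval, e15, h₂.wt i hi, add_comm]
  · simp only [if_neg hn]
    exact ⟨k₃, by simp [e21, hI₂], by simp [e22, hI₃]⟩

/-- Record in register `3` whether the table has a winning entry. -/
def accept : LoopProgram :=
  .loop 16 6 (.loop 17 5 (when (.and (.lt (.reg 0) (.add (.reg 16) (.reg 16)))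
    (.arr 7 (.reg 16) (.reg 17))) (.setReg 3 (.lit 1))))

theorem run_accept (h : Holds C S) {P : Prop} (h3 : IsFlag (S.reg 3) P) :
    IsFlag ((accept.run S).reg 3)
      (P ∨ ∃ m < N.n + 1, ∃ D < C.size, N.n < m + m ∧ S.arr 7 m D ≠ 0) := by
  refine loop_rule (P := fun S' => IsFlag (S'.reg 3) (P ∨ ∃ m < N.n + 1, ∃ D < C.size,
      N.n < m + m ∧ S.arr 7 m D ≠ 0))
    (fun i S' => IsFlag (S'.reg 3) (P ∨ ∃ m < i, ∃ D < C.size, N.n < m + m ∧ S.arr 7 m D ≠ 0))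
    (h3.congr (by simp)) ?_ fun S' _ hI => by rw [h.bound] at hI; exact hI
  intro i hi S₁ hf₁ hx₁ hI
  have h₁ : Holds C S₁ := h.of_frame hf₁ rfl
  refine loop_rule (S := S₁) (P := fun S' => IsFlag ((S'.setReg 16 (i + 1)).reg 3)
      (P ∨ ∃ m < i + 1, ∃ D < C.size, N.n < m + m ∧ S.arr 7 m D ≠ 0))
    (fun j S' => IsFlag (S'.reg 3) (P ∨ (∃ m < i, ∃ D < C.size, N.n < m + m ∧ S.arr 7 m D ≠ 0) ∨
      ∃ D < j, N.n < i + i ∧ S.arr 7 i D ≠ 0)) (hI.congr (by simp)) ?_ ?_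
  · intro j hj S₂ hf₂ hx₂ hI₂
    have h₂ : Holds C S₂ := h₁.of_frame hf₂ rfl
    have e7 : S₂.arr 7 = S.arr 7 := by rw [hf₂.arr 7 rfl, hf₁.arr 7 rfl]
    have hc : (Expr.and (.lt (.reg 0) (.add (.reg 16) (.reg 16)))
        (.arr 7 (.reg 16) (.reg 17))).eval S₂ ≠ 0 ↔ N.n < i + i ∧ S.arr 7 i j ≠ 0 := by
      rw [Expr.eval_and, Expr.eval_lt]
      simp only [Expr.eval, h₂.n, hf₂.reg 16 rfl, hx₁, hx₂, e7]
    have hex : (∃ D < j + 1, N.n < i + i ∧ S.arr 7 i D ≠ 0) ↔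
        (∃ D < j, N.n < i + i ∧ S.arr 7 i D ≠ 0) ∨ (N.n < i + i ∧ S.arr 7 i j ≠ 0) := by
      simp only [Nat.lt_succ_iff_lt_or_eq, or_and_right, exists_or, exists_eq_left]
    simp only [when, run, hc, hex]
    by_cases hn : N.n < i + i ∧ S.arr 7 i j ≠ 0
    · simp [hn, Expr.eval, IsFlag]
    · simp only [hn, or_false]
      exact hI₂
  · intro S' _ hI'
    have hex : (∃ m < i + 1, ∃ D < C.size, N.n < m + m ∧ S.arr 7 m D ≠ 0) ↔
        (∃ m < i, ∃ D < C.size, N.n < m + m ∧ S.arr 7 m D ≠ 0) ∨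
          ∃ D < C.size, N.n < i + i ∧ S.arr 7 i D ≠ 0 := by
      simp only [Nat.lt_succ_iff_lt_or_eq, or_and_right, exists_or, exists_eq_left]
    rw [h₁.size] at hI'
    rw [hex]
    exact hI'

/-- Process the guess in register `13` for the part of `X` that is bought. -/
def tryGuess : LoopProgram :=
  fill 7 (.lit 0) ;; payChosen ;; winVertices ;; .setArr 7 (.reg 21) (.reg 22) (.reg 20) ;;
    .loop 14 0 addCluster ;; accept

theorem run_tryGuess (h : Holds C S) {g : ℕ} (h13 : S.reg 13 = g) {P : Prop}
    (h3 : IsFlag (S.reg 3) P) :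
    IsFlag ((tryGuess.run S).reg 3) (P ∨ C.Wins (C.decode g)) := by
  simp only [tryGuess, run]
  have k₁ := run_fill (S := S) (a := 7) (e := .lit 0) (fun _ _ => 0) (fun _ _ _ => rfl)
  rw [h.bound, h.size] at k₁
  have f₁ := frame_run (fill 7 (.lit 0)) S
  generalize (fill 7 (.lit 0)).run S = S₁ at *
  have h₁ : Holds C S₁ := h.of_frame f₁ rfl
  have k₂ := run_payChosen h₁ (g := g) (by rw [f₁.reg 13 rfl, h13])
  have f₂ := frame_run payChosen S₁
  generalize payChosen.run S₁ = S₂ at *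
  have h₂ : Holds C S₂ := h₁.of_frame f₂ rfl
  have k₃ := run_winVertices h₂ (g := g) (by rw [f₂.reg 13 rfl, f₁.reg 13 rfl, h13])
  have f₃ := frame_run winVertices S₂
  generalize winVertices.run S₂ = S₃ at *
  have h₃ : Holds C S₃ := h₂.of_frame f₃ rfl
  set p₄ : LoopProgram := .setArr 7 (.reg 21) (.reg 22) (.reg 20) with hp₄
  have k₄ : ∀ m ≤ N.n, ∀ D < C.size, (p₄.run S₃).arr 7 m D =
      if m = N.count (C.decode g) ∧ D = C.code (C.decode g) then
        N.budget + 1 - N.total (C.decode g) else 0 := by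
    intro m hm D hD
    simp only [hp₄, run, Store.setArr_arr, Expr.eval, true_and, k₃.2.1, k₃.2.2, f₃.reg 20 rfl, k₂]
    rw [f₃.arr 7 rfl, f₂.arr 7 rfl, k₁ m (Nat.lt_succ_of_le hm) D hD]
  have f₄ := frame_run p₄ S₃
  change IsFlag ((accept.run ((loop 14 0 addCluster).run (p₄.run S₃))).reg 3) _
  generalize p₄.run S₃ = S₄ at *
  have h₄ : Holds C S₄ := h₃.of_frame f₄ rfl
  have k₅ : C.Sound (C.Upto (C.decode g) N.n) (((loop 14 0 addCluster).run S₄).arr 7) ∧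
      C.Complete (C.Upto (C.decode g) N.n) (((loop 14 0 addCluster).run S₄).arr 7) := by
    refine loop_rule (P := fun S' => C.Sound (C.Upto (C.decode g) N.n) (S'.arr 7) ∧
        C.Complete (C.Upto (C.decode g) N.n) (S'.arr 7))
      (fun r S' => C.Sound (C.Upto (C.decode g) r) (S'.arr 7) ∧
        C.Complete (C.Upto (C.decode g) r) (S'.arr 7))
      ⟨Clustering.sound_init (Clustering.decode_subset g) k₄, Clustering.complete_init k₄⟩ ?_
      fun S' _ hI => by rw [h₄.n] at hI; exact hI
    rintro r hr S' hf hx ⟨hI, hI'⟩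
    refine run_addCluster (h₄.of_frame hf rfl) hx ?_ hI hI'
    rw [hf.arr 9 rfl, f₄.arr 9 rfl]
    exact k₃.1
  have f₅ := frame_run (loop 14 0 addCluster) S₄
  generalize (loop 14 0 addCluster).run S₄ = S₅ at *
  have h₅ : Holds C S₅ := h₄.of_frame f₅ rfl
  rw [Clustering.wins_iff k₅.1 k₅.2]
  refine run_accept h₅ ?_
  rwa [f₅.reg 3 rfl, f₄.reg 3 rfl, f₃.reg 3 rfl, f₂.reg 3 rfl, f₁.reg 3 rfl]

/-- Try all guesses. -/
def search : LoopProgram := .loop 13 5 tryGuess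

theorem run_search (h : Holds C S) (h3 : S.reg 3 = 0) :
    IsFlag ((search.run S).reg 3) N.IsYes := by
  rw [C.isYes_iff]
  refine loop_rule (S := S) (x := 13) (P := fun S' => IsFlag (S'.reg 3)
      (∃ g < C.size, C.Wins (C.decode g)))
    (fun i S' => IsFlag (S'.reg 3) (∃ g < i, C.Wins (C.decode g))) (by simp [h3, IsFlag]) ?_
    fun S' _ hI => by rw [h.size] at hI; exact hI
  intro g hg S' hf hx hI
  refine (run_tryGuess (h.of_frame hf rfl) hx hI).congr ?_
  simp only [Nat.lt_succ_iff_lt_or_eq, or_and_right, exists_or, exists_eq_left]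

end

/-! ## The program for finding a clustering

Array `3` indicates the vertices of `X`. -/

/-! ### Binary codes for the subsets of `X`. -/

/-- The rank of `v` in `X`. -/
noncomputable def rank (X : Finset ℕ) (v : ℕ) : ℕ := (X.filter (· < v)).card

theorem rank_lt_rank {X : Finset ℕ} {u v : ℕ} (hu : u ∈ X) (huv : u < v) :
    rank X u < rank X v := by
  refine Finset.card_lt_card (Finset.ssubset_iff_of_subset ?_ |>.2 ⟨u, ?_, ?_⟩)
  · intro x hx
    simp only [Finset.mem_filter] at hx ⊢
    exact ⟨hx.1, hx.2.trans huv⟩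
  · simp [hu, huv]
  · simp

theorem rank_lt_card {X : Finset ℕ} {v : ℕ} (hv : v ∈ X) : rank X v < X.card :=
  Finset.card_lt_card (Finset.filter_ssubset.2 ⟨v, hv, lt_irrefl v⟩)

theorem rank_injOn (X : Finset ℕ) : Set.InjOn (rank X) X := by
  intro u hu v hv h
  rcases lt_trichotomy u v with huv | huv | huv
  · exact absurd h (rank_lt_rank hu huv).ne
  · exact huv
  · exact absurd h (rank_lt_rank hv huv).ne'

theorem rank_succ (X : Finset ℕ) (v : ℕ) :
    rank X (v + 1) = rank X v + if v ∈ X then 1 else 0 := by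
  simp only [rank, Nat.lt_succ_iff_lt_or_eq, Finset.filter_or]
  rw [Finset.card_union_of_disjoint]
  · congr 1
    rw [Finset.filter_eq']
    split_ifs <;> simp
  · rw [Finset.disjoint_filter]
    intro x _ h1 h2
    omega

/-- The weight of `v` in the encoding of subsets of `X`. -/
noncomputable def weight (X : Finset ℕ) (v : ℕ) : ℕ := if v ∈ X then 2 ^ rank X v else 0

theorem sum_weight {X Y : Finset ℕ} (h : Y ⊆ X) :
    ∑ x ∈ Y, weight X x = ∑ i ∈ Y.image (rank X), 2 ^ i := by
  rw [Finset.sum_image fun x hx y hy => rank_injOn X (h hx) (h hy)]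
  exact Finset.sum_congr rfl fun x hx => if_pos (h hx)

theorem sum_weight_lt {X Y : Finset ℕ} (h : Y ⊆ X) : ∑ x ∈ Y, weight X x < 2 ^ X.card := by
  rw [sum_weight h]
  refine Nat.geomSum_lt le_rfl fun i hi => ?_
  obtain ⟨x, hx, rfl⟩ := Finset.mem_image.1 hi
  exact rank_lt_card (h hx)

/-- The weights on `X` are distinct powers of two, so the code of `Y` has the ranks of the elements
of `Y` as its binary digits, and rank is injective on `X`. -/
theorem bit_sum_weight {X Y : Finset ℕ} (h : Y ⊆ X) {x : ℕ} (hx : x ∈ X) :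
    (∑ y ∈ Y, weight X y) / weight X x % 2 ≠ 0 ↔ x ∈ Y := by
  rw [sum_weight h, weight, if_pos hx, ← Nat.toNat_testBit, ne_eq, Bool.toNat_eq_zero,
    Bool.not_eq_false, ← Nat.mem_bitIndices, ← List.mem_toFinset,
    Finset.toFinset_bitIndices_sum_two_pow, Finset.mem_image]
  constructor
  · rintro ⟨y, hy, hxy⟩
    rwa [← rank_injOn X (h hy) hx hxy]
  · exact fun hxY => ⟨x, hxY, rfl⟩

/-- The number `x` is `0` or the successor of the last vertex below `U` that is outside `X` and
adjacent to `v`. -/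
def IsLast (N : Net) (X : Finset ℕ) (U v x : ℕ) : Prop :=
  (x = 0 ∧ ∀ u < U, u ∉ X → ¬ N.adj u v) ∨
    ∃ r < U, x = r + 1 ∧ r ∉ X ∧ N.adj r v ∧ ∀ u < U, r < u → u ∉ X → ¬ N.adj u v

/-- Clusters are named by their last vertices. -/
noncomputable def clusteringOf (N : Net) (X : Finset ℕ) (rep : ℕ → ℕ)
    (hX : X ⊆ Finset.range N.n)
    (hrefl : ∀ v < N.n, N.adj v v)
    (hsymm : ∀ u v, N.adj u v → N.adj v u)
    (htrans : ∀ u < N.n, ∀ v < N.n, ∀ w < N.n, u ∉ X → v ∉ X → w ∉ X →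
      N.adj u v → N.adj v w → N.adj u w)
    (h0 : ∀ v < N.n, v ∈ X → rep v = 0)
    (h1 : ∀ v < N.n, v ∉ X → IsLast N X N.n v (rep v)) : Clustering N where
  X := X
  rep := rep
  wt := weight X
  size := 2 ^ X.card
  subset := hX
  rep_eq_zero v hv := by
    refine ⟨fun h => ?_, h0 v hv⟩
    by_contra hvX
    rcases h1 v hv hvX with ⟨-, h2⟩ | ⟨r, -, h2, -⟩
    · exact h2 v hv hvX (hrefl v hv)
    · omega
  rep_le v hv := by
    by_cases hvX : v ∈ X
    · rw [h0 v hv hvX]; exact Nat.zero_le _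
    · rcases h1 v hv hvX with ⟨h2, -⟩ | ⟨r, hr, h2, -⟩ <;> omega
  adj_iff u hu v hv huX hvX := by
    rcases h1 u hu huX with ⟨-, h2⟩ | ⟨r, hr, h2, hrX, hru, hr'⟩
    · exact absurd (hrefl u hu) (h2 u hu huX)
    rcases h1 v hv hvX with ⟨-, h3⟩ | ⟨s, hs, h3, hsX, hsv, hs'⟩
    · exact absurd (hrefl v hv) (h3 v hv hvX)
    rw [h2, h3]
    constructor
    · intro h
      have h4 : N.adj r v := htrans r hr u hu v hv hrX huX hvX hru h
      have h5 : N.adj s u := htrans s hs v hv u hu hsX hvX huX hsv (hsymm _ _ h)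
      -- By transitivity each of the two last neighbours `r`, `s` is adjacent to both `u` and `v`;
      -- if they differed, the larger one would refute that the smaller one is last.
      rcases lt_trichotomy r s with hrs | rfl | hrs
      · exact absurd h5 (hr' s hs hrs hsX)
      · rfl
      · exact absurd h4 (hs' r hr hrs hrX)
    · intro h
      obtain rfl : r = s := by omega
      exact htrans u hu r hr v hv huX hrX hvX (hsymm _ _ hru) hsv
  wt_eq_zero v _ := by
    by_cases h : v ∈ X <;> simp [weight, h]
  code_lt Y hY := sum_weight_lt hY
  bit_code Y hY x hx := bit_sum_weight hY hx

/-- Make the adjacency matrix reflexive. -/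
def closeAdj : LoopProgram := .loop 10 0 (.setArr 0 (.reg 10) (.reg 10) (.lit 1))

section

variable {S : Store}

theorem run_closeAdj :
    ∀ u < S.reg 0, ∀ v, (closeAdj.run S).arr 0 u v ≠ 0 ↔ u = v ∨ S.arr 0 u v ≠ 0 := by
  refine loop_rule
    (P := fun S' => ∀ u < S.reg 0, ∀ v, S'.arr 0 u v ≠ 0 ↔ u = v ∨ S.arr 0 u v ≠ 0)
    (fun i S' => ∀ u v, S'.arr 0 u v ≠ 0 ↔ (u < i ∧ u = v) ∨ S.arr 0 u v ≠ 0) (by simp) ?_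
    fun S' _ h u hu v => by simp [h, hu]
  intro i hi S' hf hx hI u v
  simp only [run, Store.setReg_arr, Store.setArr_arr, Expr.eval, hx, true_and]
  by_cases h : u = i ∧ v = i
  · rw [if_pos h]
    simp [h.1, h.2]
  · rw [if_neg h, hI]
    refine or_congr_left ?_
    omega

/-- The set `Y` meets all paths of the network with three vertices. -/
def Net.Hits (N : Net) (Y : Finset ℕ) : Prop :=
  ∀ u < N.n, ∀ v < N.n, ∀ w < N.n, N.adj u v → N.adj v w → ¬ N.adj u w →
    u ∈ Y ∨ v ∈ Y ∨ w ∈ Y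

/-- If the vertices in registers `10`, `11`, `12` form a path outside `X`, add them to `X`. -/
def takePath : LoopProgram :=
  when (.and (.not (.arr 3 (.reg 10) (.lit 0))) (.and (.not (.arr 3 (.reg 11) (.lit 0)))
    (.and (.not (.arr 3 (.reg 12) (.lit 0))) (.and (.arr 0 (.reg 10) (.reg 11))
      (.and (.arr 0 (.reg 11) (.reg 12)) (.not (.arr 0 (.reg 10) (.reg 12))))))))
  (.setArr 3 (.reg 10) (.lit 0) (.lit 1) ;; .setArr 3 (.reg 11) (.lit 0) (.lit 1) ;;
    .setArr 3 (.reg 12) (.lit 0) (.lit 1))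

/-- The set `X` is stored in array `3`, and each set that hits all paths contains at least a third
of `X`. -/
structure Packing (N : Net) (X : Finset ℕ) (S : Store) : Prop where
  subset : X ⊆ Finset.range N.n
  mem : ∀ v, S.arr 3 v 0 ≠ 0 ↔ v ∈ X
  card_le : ∀ Y, N.Hits Y → X.card ≤ 3 * (Y ∩ X).card

/-- If a path is added, it is disjoint from `X`, and a hitting set contains at least one of its
three vertices. Thus both sides of `card_le` grow by at least the required `3`; bounding by `Y ∩ X`
rather than by `Y` makes the estimate additive. -/
theorem run_takePath {N : Net} (hrefl : ∀ v < N.n, N.adj v v)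
    (h : ∀ u < N.n, ∀ v < N.n, S.arr 0 u v ≠ 0 ↔ N.adj u v) {u v w : ℕ}
    (h10 : S.reg 10 = u) (h11 : S.reg 11 = v) (h12 : S.reg 12 = w) (hu : u < N.n) (hv : v < N.n)
    (hw : w < N.n) {X : Finset ℕ} (hX : Packing N X S) :
    ∃ X', X ⊆ X' ∧ Packing N X' (takePath.run S) ∧
      (u ∈ X' ∨ v ∈ X' ∨ w ∈ X' ∨ (N.adj u v → N.adj v w → N.adj u w)) := by
  have hn : ∀ x, S.arr 3 x 0 = 0 ↔ x ∉ X := fun x => by rw [← hX.mem, not_not]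
  have hc : (Expr.and (.not (.arr 3 (.reg 10) (.lit 0))) (.and (.not (.arr 3 (.reg 11) (.lit 0)))
      (.and (.not (.arr 3 (.reg 12) (.lit 0))) (.and (.arr 0 (.reg 10) (.reg 11))
      (.and (.arr 0 (.reg 11) (.reg 12)) (.not (.arr 0 (.reg 10) (.reg 12)))))))).eval S ≠ 0 ↔
      u ∉ X ∧ v ∉ X ∧ w ∉ X ∧ N.adj u v ∧ N.adj v w ∧ ¬ N.adj u w := by
    simp only [Expr.eval_and, Expr.eval_not]
    simp only [Expr.eval, h10, h11, h12, hn, h u hu v hv, h v hv w hw, ← h u hu w hw, not_not]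
  simp only [takePath, when, run, hc]
  split_ifs with hp
  · obtain ⟨huX, hvX, hwX, huv, hvw, huw⟩ := hp
    -- Since adjacency contains the loops, the three vertices are distinct.
    have n1 : u ≠ v := by rintro rfl; exact huw hvw
    have n2 : v ≠ w := by rintro rfl; exact huw huv
    have n3 : u ≠ w := by rintro rfl; exact huw (hrefl u hu)
    refine ⟨{u, v, w} ∪ X, Finset.subset_union_right, ⟨?_, fun x => ?_, fun Y hY => ?_⟩,
      Or.inl (by simp)⟩
    · refine Finset.union_subset ?_ hX.subset
      simp [Finset.insert_subset_iff, hu, hv, hw]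
    · simp only [Store.setArr_arr, Store.setArr_reg, Expr.eval, h10, h11, h12, true_and, and_true,
        Finset.mem_union, Finset.mem_insert, Finset.mem_singleton, ← hX.mem]
      split_ifs with e₁ e₂ e₃
      · simp [e₁]
      · simp [e₂]
      · simp [e₃]
      · simp [e₁, e₂, e₃]
    · have hd : Disjoint ({u, v, w} : Finset ℕ) X := by simp [huX, hvX, hwX]
      have hd' : Disjoint (Y ∩ {u, v, w}) (Y ∩ X) :=
        hd.mono Finset.inter_subset_right Finset.inter_subset_right
      have h3 : ({u, v, w} : Finset ℕ).card = 3 := Finset.card_eq_three.2 ⟨u, v, w, n1, n3, n2, rfl⟩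
      have h4 : 0 < (Y ∩ {u, v, w}).card := by
        refine Finset.card_pos.2 ?_
        rcases hY u hu v hv w hw huv hvw huw with hm | hm | hm
        · exact ⟨u, by simp [hm]⟩
        · exact ⟨v, by simp [hm]⟩
        · exact ⟨w, by simp [hm]⟩
      rw [Finset.card_union_of_disjoint hd, Finset.inter_union_distrib_left,
        Finset.card_union_of_disjoint hd', h3]
      have := hX.card_le Y hY
      omega
  · refine ⟨X, subset_rfl, hX, ?_⟩
    by_contra hg
    simp only [not_or, Classical.not_imp] at hg
    exact hp hg

/-- Remove disjoint paths as long as there are any. -/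
def takePaths : LoopProgram := .loop 10 0 (.loop 11 0 (.loop 12 0 takePath))

/-- One pass over all triples suffices: `X` only grows, so a triple that is met by `X` stays met,
and a triple that is no induced path never becomes one. -/
theorem run_takePaths {N : Net} (h0 : S.reg 0 = N.n) (hrefl : ∀ v < N.n, N.adj v v)
    (h : ∀ u < N.n, ∀ v < N.n, S.arr 0 u v ≠ 0 ↔ N.adj u v) (h3 : ∀ v, S.arr 3 v 0 = 0) :
    ∃ X, Packing N X (takePaths.run S) ∧ ∀ u < N.n, ∀ v < N.n, ∀ w < N.n,
      u ∉ X → v ∉ X → w ∉ X → N.adj u v → N.adj v w → N.adj u w := by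
  let Inv : Store → Prop := fun S' => ∃ X, Packing N X S'
  let le : Store → Store → Prop := fun S₁ S₂ => ∀ v, S₁.arr 3 v 0 ≠ 0 → S₂.arr 3 v 0 ≠ 0
  let R : ℕ → ℕ → ℕ → Store → Prop := fun u v w S' => S'.arr 3 u 0 ≠ 0 ∨ S'.arr 3 v 0 ≠ 0 ∨
    S'.arr 3 w 0 ≠ 0 ∨ (N.adj u v → N.adj v w → N.adj u w)
  have htrans : ∀ S₁ S₂ S₃, le S₁ S₂ → le S₂ S₃ → le S₁ S₃ :=
    fun S₁ S₂ S₃ h₁ h₂ v hv => h₂ v (h₁ v hv)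
  have hR : ∀ u v w S₁ S₂, le S₁ S₂ → R u v w S₁ → R u v w S₂ := fun u v w S₁ S₂ h₁ h₂ =>
    h₂.imp (h₁ _) (Or.imp (h₁ _) (Or.imp_left (h₁ _)))
  have hle : ∀ (S : Store) (x w : ℕ), le S (S.setReg x w) := fun S x w v hv => hv
  have hInv : ∀ (S : Store) (x w : ℕ), Inv S → Inv (S.setReg x w) :=
    fun S x w ⟨X, hX⟩ => ⟨X, hX.1, hX.2, hX.3⟩
  have key := loop_collect (S := S) (x := 10) (b := 0) (p := .loop 11 0 (.loop 12 0 takePath))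
    Inv le (fun u S' => ∀ v < N.n, ∀ w < N.n, R u v w S') htrans
    (fun u S₁ S₂ h₁ h₂ v hv w hw => hR u v w S₁ S₂ h₁ (h₂ v hv w hw)) (fun S => hle S _)
    (fun S => hInv S _) ⟨∅, by simp, by simp [h3], by simp⟩ ?_
  · obtain ⟨⟨X, hX⟩, -, k⟩ := key
    refine ⟨X, hX, fun u hu v hv w hw huX hvX hwX => ?_⟩
    rw [h0] at k
    rcases k u hu v hv w hw with k | k | k | k
    · exact absurd ((hX.mem u).1 k) huX
    · exact absurd ((hX.mem v).1 k) hvX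
    · exact absurd ((hX.mem w).1 k) hwX
    · exact k
  intro u hu S₁ hf₁ h10 hI₁
  have key := loop_collect (S := S₁) (x := 11) (b := 0) (p := .loop 12 0 takePath)
    Inv le (fun v S' => ∀ w < N.n, R u v w S') htrans
    (fun v S₁ S₂ h₁ h₂ w hw => hR u v w S₁ S₂ h₁ (h₂ w hw)) (fun S => hle S _)
    (fun S => hInv S _) hI₁ ?_
  · rw [hf₁.reg 0 rfl, h0] at key
    exact key
  intro v hv S₂ hf₂ h11 hI₂
  have hf₂' := hf₁.trans (hf₂.loop 10 0)
  have key := loop_collect (S := S₂) (x := 12) (b := 0) (p := takePath)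
    Inv le (fun w S' => R u v w S') htrans (fun w => hR u v w) (fun S => hle S _)
    (fun S => hInv S _) hI₂ ?_
  · rw [hf₂'.reg 0 rfl, h0] at key
    exact key
  rintro w hw S₃ hf₃ h12 ⟨X, hX⟩
  have hf₃' := hf₂'.trans ((hf₃.loop 11 0).loop 10 0)
  rw [h0] at hu
  rw [hf₁.reg 0 rfl, h0] at hv
  rw [hf₂'.reg 0 rfl, h0] at hw
  obtain ⟨X', hXX, hX', hd⟩ := run_takePath hrefl (by rw [hf₃'.arr 0 rfl]; exact h)
    (by rw [hf₃.reg 10 rfl, hf₂.reg 10 rfl, h10]) (by rw [hf₃.reg 11 rfl, h11]) h12 hu hv hw hX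
  refine ⟨⟨X', hX'⟩, fun x hx => (hX'.mem x).2 (hXX ((hX.mem x).1 hx)), ?_⟩
  simp only [R, hX'.mem]
  exact hd

/-- Name the clusters outside `X`. -/
def nameClusters : LoopProgram :=
  .loop 10 0 (.loop 11 0 (when (.and (.not (.arr 3 (.reg 10) (.lit 0)))
    (.and (.not (.arr 3 (.reg 11) (.lit 0))) (.arr 0 (.reg 10) (.reg 11))))
    (.setArr 6 (.reg 11) (.lit 0) (.add (.reg 10) (.lit 1)))))

/-- The outer loop runs through `u` in increasing order and overwrites earlier names, so the name
that remains comes from the largest neighbour outside `X`. -/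
theorem run_nameClusters {N : Net} (h0 : S.reg 0 = N.n)
    (h : ∀ u < N.n, ∀ v < N.n, S.arr 0 u v ≠ 0 ↔ N.adj u v) {X : Finset ℕ}
    (h3 : ∀ v, S.arr 3 v 0 ≠ 0 ↔ v ∈ X) (h6 : ∀ v, S.arr 6 v 0 = 0) :
    ∀ v < N.n, (v ∈ X → (nameClusters.run S).arr 6 v 0 = 0) ∧
      (v ∉ X → IsLast N X N.n v ((nameClusters.run S).arr 6 v 0)) := by
  refine loop_rule (P := fun S' => ∀ v < N.n, (v ∈ X → S'.arr 6 v 0 = 0) ∧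
      (v ∉ X → IsLast N X N.n v (S'.arr 6 v 0)))
    (fun i S' => ∀ v < N.n, (v ∈ X → S'.arr 6 v 0 = 0) ∧
      (v ∉ X → IsLast N X i v (S'.arr 6 v 0))) (fun v _ => by simp [h6, IsLast]) ?_
    fun S' _ hI => by rw [h0] at hI; exact hI
  intro u hu S₁ hf₁ h10 hI
  rw [h0] at hu
  have hn : ∀ x, S.arr 3 x 0 = 0 ↔ x ∉ X := fun x => by rw [← h3, not_not]
  have hS₁ : S₁.reg 0 = N.n := by rw [hf₁.reg 0 rfl, h0]
  refine loop_rule (S := S₁) (P := fun S' => ∀ v < N.n,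
      (v ∈ X → (S'.setReg 10 (u + 1)).arr 6 v 0 = 0) ∧
      (v ∉ X → IsLast N X (u + 1) v ((S'.setReg 10 (u + 1)).arr 6 v 0)))
    (fun j S' => ∀ v < N.n, S'.arr 6 v 0 =
      if v < j ∧ u ∉ X ∧ v ∉ X ∧ N.adj u v then u + 1 else S₁.arr 6 v 0) (by simp) ?_ ?_
  · intro j hj S₂ hf₂ h11 hI₂ v hv
    have hf := hf₁.trans (hf₂.loop 10 0)
    rw [hS₁] at hj
    have e10 : S₂.reg 10 = u := by rw [hf₂.reg 10 rfl, h10]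
    have hc : (Expr.and (.not (.arr 3 (.reg 10) (.lit 0)))
        (.and (.not (.arr 3 (.reg 11) (.lit 0))) (.arr 0 (.reg 10) (.reg 11)))).eval S₂ ≠ 0 ↔
        u ∉ X ∧ j ∉ X ∧ N.adj u j := by
      simp only [Expr.eval_and, Expr.eval_not]
      simp only [Expr.eval, e10, h11, hf.arr 3 rfl, hf.arr 0 rfl, hn, h u hu j hj]
    simp only [when, run, hc]
    by_cases hp : u ∉ X ∧ j ∉ X ∧ N.adj u j
    · rw [if_pos hp]
      simp only [Store.setReg_arr, Store.setArr_arr, Expr.eval, h11, e10, true_and, and_true]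
      by_cases hvj : v = j
      · subst hvj
        rw [if_pos rfl, if_pos ⟨Nat.lt_succ_self v, hp⟩]
      · rw [if_neg hvj, hI₂ v hv]
        refine if_congr (and_congr_left fun _ => ?_) rfl rfl
        omega
    · rw [if_neg hp, Store.setReg_arr, hI₂ v hv]
      refine if_congr ⟨fun k => ⟨k.1.trans (Nat.lt_succ_self j), k.2⟩, fun k => ⟨?_, k.2⟩⟩ rfl rfl
      rcases Nat.lt_succ_iff_lt_or_eq.1 k.1 with hv | rfl
      · exact hv
      · exact absurd k.2 hp
  · intro S' _ hI' v hv
    rw [Store.setReg_arr, hI' v hv, hS₁]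
    obtain ⟨k₁, k₂⟩ := hI v hv
    by_cases hp : u ∉ X ∧ v ∉ X ∧ N.adj u v
    · rw [if_pos ⟨hv, hp⟩]
      refine ⟨fun k => absurd k hp.2.1, fun _ => Or.inr ⟨u, Nat.lt_succ_self u, rfl, hp.1,
        hp.2.2, fun w hw huw => ?_⟩⟩
      omega
    · rw [if_neg fun k => hp k.2]
      refine ⟨k₁, fun hvX => ?_⟩
      have hu' : u ∉ X → ¬ N.adj u v := fun k k' => hp ⟨k, hvX, k'⟩
      rcases k₂ hvX with ⟨k₃, k₄⟩ | ⟨r, hr, k₃, k₄, k₅, k₆⟩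
      · refine Or.inl ⟨k₃, fun w hw => ?_⟩
        rcases Nat.lt_succ_iff_lt_or_eq.1 hw with hw | rfl
        · exact k₄ w hw
        · exact hu'
      · refine Or.inr ⟨r, hr.trans (Nat.lt_succ_self u), k₃, k₄, k₅, fun w hw hrw => ?_⟩
        rcases Nat.lt_succ_iff_lt_or_eq.1 hw with hw | rfl
        · exact k₆ w hw hrw
        · exact hu'

/-- Assign the weights to the vertices of `X`. -/
def assignWeights : LoopProgram :=
  .setReg 6 (.add (.reg 0) (.lit 1)) ;; .setReg 5 (.lit 1) ;;
  .loop 11 0 (when (.arr 3 (.reg 11) (.lit 0))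
    (.setArr 5 (.reg 11) (.lit 0) (.reg 5) ;; .setReg 5 (.add (.reg 5) (.reg 5))))

theorem run_assignWeights {n : ℕ} (h0 : S.reg 0 = n) {X : Finset ℕ}
    (h3 : ∀ v, S.arr 3 v 0 ≠ 0 ↔ v ∈ X) (hX : X ⊆ Finset.range n) (h5 : ∀ v, S.arr 5 v 0 = 0) :
    (assignWeights.run S).reg 6 = n + 1 ∧ (assignWeights.run S).reg 5 = 2 ^ X.card ∧
      ∀ v < n, (assignWeights.run S).arr 5 v 0 = weight X v := by
  simp only [assignWeights, run_seq, run_setReg, Expr.eval, h0]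
  set S₁ := (S.setReg 6 (n + 1)).setReg 5 1 with hS₁
  have hS₁0 : S₁.reg 0 = n := by simp [hS₁, h0]
  refine loop_rule (S := S₁) (x := 11)
    (P := fun S' => S'.reg 6 = n + 1 ∧ S'.reg 5 = 2 ^ X.card ∧
      ∀ v < n, S'.arr 5 v 0 = weight X v)
    (fun i S' => S'.reg 5 = 2 ^ rank X i ∧
      ∀ v, S'.arr 5 v 0 = if v < i then weight X v else 0) (by simp [hS₁, h5, rank]) ?_ ?_
  · rintro i hi S' hf hx ⟨hI₁, hI₂⟩
    have e3 : S'.arr 3 = S.arr 3 := hf.arr 3 rfl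
    have hc : (Expr.arr 3 (.reg 11) (.lit 0)).eval S' ≠ 0 ↔ i ∈ X := by
      simp only [Expr.eval, hx, e3, h3]
    simp only [when, run, hc, rank_succ]
    by_cases hi : i ∈ X
    · simp only [if_pos hi]
      refine ⟨by simp [Expr.eval, hI₁, pow_succ, mul_two], fun v => ?_⟩
      simp only [Store.setReg_arr, Store.setArr_arr, Expr.eval, hx, hI₁, hI₂, true_and, and_true]
      by_cases hv : v = i
      · subst hv
        simp [weight, hi]
      · rw [if_neg hv]
        refine if_congr ?_ rfl rfl
        omega
    · simp only [if_neg hi]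
      refine ⟨by simp [hI₁], fun v => ?_⟩
      rw [Store.setReg_arr, hI₂]
      by_cases hv : v = i
      · subst hv
        simp [weight, hi]
      · refine if_congr ?_ rfl rfl
        omega
  · rintro S' hf ⟨hI₁, hI₂⟩
    rw [hS₁0] at hI₁ hI₂
    refine ⟨by rw [hf.reg 6 rfl]; simp [hS₁], ?_, fun v hv => by rw [hI₂, if_pos hv]⟩
    rw [hI₁, rank, Finset.filter_true_of_mem]
    exact fun x hx => Finset.mem_range.1 (hX hx)

/-- Find a clustering. -/
def prepare : LoopProgram := closeAdj ;; takePaths ;; nameClusters ;; assignWeights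

/-- The bound on `C.size` holds for every hitting set `Y`, in particular for an optimal one, which
the program never computes. -/
theorem run_prepare {N : Net} (h0 : S.reg 0 = N.n) (h2 : S.reg 2 = N.budget)
    (hadj : ∀ u < N.n, ∀ v < N.n, u = v ∨ S.arr 0 u v ≠ 0 ↔ N.adj u v)
    (hsymm : ∀ u v, N.adj u v → N.adj v u)
    (htop : ∀ v < N.n, S.arr 1 v (S.reg 1) = 0 ↔ N.top v)
    (hprice : ∀ v < N.n, S.arr 2 v 0 = N.price v)
    (hz : ∀ a ≥ 3, ∀ v, S.arr a v 0 = 0) :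
    ∃ C : Clustering N, Holds C (prepare.run S) ∧
      ∀ Y, N.Hits Y → C.size ≤ 2 ^ (3 * Y.card) := by
  have f := frame_run prepare S
  simp only [prepare, run_seq] at f ⊢
  have k₁ := run_closeAdj (S := S)
  have f₁ := frame_run closeAdj S
  generalize closeAdj.run S = S₁ at *
  have hrefl : ∀ v < N.n, N.adj v v := fun v hv => (hadj v hv v hv).1 (Or.inl rfl)
  have a₁ : ∀ u < N.n, ∀ v < N.n, S₁.arr 0 u v ≠ 0 ↔ N.adj u v := fun u hu v hv => by
    rw [k₁ u (by omega), hadj u hu v hv]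
  obtain ⟨X, hX, htrans⟩ := run_takePaths (by rw [f₁.reg 0 rfl, h0]) hrefl a₁
    (by rw [f₁.arr 3 rfl]; exact hz 3 le_rfl)
  have f₂ := frame_run takePaths S₁
  generalize takePaths.run S₁ = S₂ at *
  have e₂ : S₂.reg 0 = N.n := by rw [f₂.reg 0 rfl, f₁.reg 0 rfl, h0]
  have a₂ : ∀ u < N.n, ∀ v < N.n, S₂.arr 0 u v ≠ 0 ↔ N.adj u v := by rwa [f₂.arr 0 rfl]
  have k₃ := run_nameClusters e₂ a₂ hX.mem
    (by rw [f₂.arr 6 rfl, f₁.arr 6 rfl]; exact hz 6 (by norm_num))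
  have f₃ := frame_run nameClusters S₂
  generalize nameClusters.run S₂ = S₃ at *
  obtain ⟨k₄, k₅, k₆⟩ := run_assignWeights (by rw [f₃.reg 0 rfl, e₂])
    (by rw [f₃.arr 3 rfl]; exact hX.mem) hX.subset
    (by rw [f₃.arr 5 rfl, f₂.arr 5 rfl, f₁.arr 5 rfl]; exact hz 5 (by norm_num))
  have f₄ := frame_run assignWeights S₃
  generalize assignWeights.run S₃ = S₄ at *
  refine ⟨clusteringOf N X (fun v => S₃.arr 6 v 0) hX.subset hrefl hsymm htrans
    (fun v hv => (k₃ v hv).1) (fun v hv => (k₃ v hv).2),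
    ⟨?_, ?_, k₅, k₄, ?_, ?_, ?_, k₆, ?_⟩, fun Y hY => ?_⟩
  · rw [f.reg 0 rfl, h0]
  · rw [f.reg 2 rfl, h2]
  · rw [f₄.arr 0 rfl, f₃.arr 0 rfl]; exact a₂
  · rw [f.arr 1 rfl, f.reg 1 rfl]; exact htop
  · rw [f.arr 2 rfl]; exact hprice
  · intro v _
    rw [f₄.arr 6 rfl]
    rfl
  · refine Nat.pow_le_pow_right two_pos ((hX.card_le Y hY).trans ?_)
    exact Nat.mul_le_mul_left 3 (Finset.card_le_card Finset.inter_subset_left)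

end

/-! ## The algorithm -/

namespace Instance

variable {n : ℕ} (I : Instance 2 n)

/-- The network of an instance with two candidates. -/
noncomputable def net : Net where
  n := n
  budget := ⌊I.budget⌋₊
  adj u v := ∃ (hu : u < n) (hv : v < n), u = v ∨ I.arc ⟨u, hu⟩ ⟨v, hv⟩
  top v := ∃ hv : v < n, (I.vote ⟨v, hv⟩ I.preferred : ℕ) = 0
  price v := if hv : v < n then I.cost ⟨v, hv⟩ 1 else 0

theorem shift_rank {m : ℕ} (σ : Vote m) (c : Fin m) (s : ℕ) :
    (σ.shift c s c : ℕ) = σ c - s := by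
  have hle : (⟨(σ c : ℕ) - s, lt_of_le_of_lt (Nat.sub_le _ _) (σ c).isLt⟩ : Fin m) ≤ σ c :=
    Fin.le_def.2 (Nat.sub_le _ _)
  have : NeZero m := ⟨fun h => (h ▸ c).elim0⟩
  simp only [Vote.shift, Equiv.trans_apply, Fin.cycleIcc_of_last hle]

/-! ### Shift bribery with two candidates as budgeted partial domination. -/

variable {I}

/-- With weight `1` the rounding disappears and the shift is a sum of zeros and ones, positive as
soon as one summand is. -/
theorem effectiveShift_pos_iff (hw : I.UniformWeights) {s : Fin n → Fin 2} {S : Finset ℕ}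
    (hsS : ∀ v, s v = 1 ↔ (v : ℕ) ∈ S) (v : Fin n) :
    0 < I.effectiveShift s v ↔ ∃ u : Fin n, (u : ℕ) ∈ S ∧ (u = v ∨ I.arc u v) := by
  have hval : ∀ u, 0 < (s u : ℕ) ↔ (u : ℕ) ∈ S := fun u => by
    rw [← hsS, Fin.ext_iff, Fin.val_one]
    omega
  have hsum : ∑ j : Fin n with j ≠ v ∧ I.arc j v, ⌊((s j : ℕ) : NNReal) * I.weight j v⌋₊ =
      ∑ j : Fin n with j ≠ v ∧ I.arc j v, (s j : ℕ) := by
    refine Finset.sum_congr rfl fun j hj => ?_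
    rw [hw _ _ (Finset.mem_filter.1 hj).2.2, mul_one, Nat.floor_natCast]
  rw [effectiveShift, hsum, add_pos_iff, hval, Finset.sum_pos_iff]
  simp only [Finset.mem_filter, Finset.mem_univ, true_and, hval]
  constructor
  · rintro (h | ⟨u, ⟨-, h1⟩, h2⟩)
    · exact ⟨v, h, Or.inl rfl⟩
    · exact ⟨u, h2, Or.inr h1⟩
  · rintro ⟨u, h1, h2⟩
    by_cases huv : u = v
    · exact Or.inl (huv ▸ h1)
    · exact Or.inr ⟨u, ⟨huv, h2.resolve_left huv⟩, h1⟩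

theorem majorityWinner_iff (hw : I.UniformWeights) {s : Fin n → Fin 2} {S : Finset ℕ}
    (hsS : ∀ v, s v = 1 ↔ (v : ℕ) ∈ S) :
    MajorityWinner (I.resultingProfile s) I.preferred ↔ n < 2 * I.net.count S := by
  have hcount : (Finset.univ.filter fun i : Fin n =>
      (I.resultingProfile s i I.preferred : ℕ) = 0).card = I.net.count S := by
    rw [Net.count, Finset.card_filter, Finset.card_filter]
    change _ = ∑ v ∈ Finset.range n, _
    rw [Finset.sum_range]
    refine Finset.sum_congr rfl fun v _ => if_congr ?_ rfl rfl
    rw [resultingProfile, shift_rank]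
    -- Ranks are at most `1`, so any positive shift reaches the top.
    have h1 : (I.vote v I.preferred : ℕ) - I.effectiveShift s v = 0 ↔
        (I.vote v I.preferred : ℕ) = 0 ∨ 0 < I.effectiveShift s v := by
      have := (I.vote v I.preferred).isLt
      omega
    rw [h1, effectiveShift_pos_iff hw hsS]
    refine or_congr ⟨fun h => ⟨v.isLt, h⟩, fun ⟨_, h⟩ => h⟩ ⟨?_, ?_⟩
    · rintro ⟨u, hu, huv⟩
      exact ⟨u, hu, u.isLt, v.isLt, huv.imp_left (congrArg Fin.val)⟩
    · rintro ⟨u, hu, hun, _, huv⟩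
      exact ⟨⟨u, hun⟩, hu, huv.imp_left Fin.ext⟩
  rw [← hcount]
  rfl

theorem cost_eq_total {s : Fin n → Fin 2} {S : Finset ℕ}
    (hS : S ⊆ Finset.range n) (hsS : ∀ v, s v = 1 ↔ (v : ℕ) ∈ S) :
    ∑ v, I.cost v (s v) = I.net.total S := by
  have h : I.net.total S = ∑ v ∈ Finset.range n, if v ∈ S then I.net.price v else 0 := by
    rw [Net.total, ← Finset.sum_filter, Finset.filter_mem_eq_inter, Finset.inter_eq_right.2 hS]
  rw [h, Finset.sum_range]
  refine Finset.sum_congr rfl fun v _ => ?_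
  by_cases hv : s v = 1
  · rw [if_pos ((hsS v).1 hv), hv]
    simp [net]
  · rw [if_neg fun h => hv ((hsS v).2 h)]
    refine I.cost_zero v _ ?_
    rw [Fin.ext_iff, Fin.val_one] at hv
    omega

theorem isYes_iff (hw : I.UniformWeights) : I.IsYes ↔ I.net.IsYes := by
  have hb : ∀ t : ℕ, (t : NNReal) ≤ I.budget ↔ t ≤ I.net.budget := fun t =>
    (Nat.le_floor_iff zero_le).symm
  constructor
  · rintro ⟨s, h1, h2⟩
    have hS : (Finset.univ.filter fun v => s v = 1).map Fin.valEmbedding ⊆ Finset.range n := by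
      intro v hv
      obtain ⟨u, -, rfl⟩ := Finset.mem_map.1 hv
      exact Finset.mem_range.2 u.isLt
    have hsS : ∀ v, s v = 1 ↔
        (v : ℕ) ∈ (Finset.univ.filter fun v => s v = 1).map Fin.valEmbedding := fun v => by
      simp [Fin.val_inj]
    refine ⟨_, hS, ?_, (majorityWinner_iff hw hsS).1 h2⟩
    rwa [← cost_eq_total hS hsS, ← hb]
  · rintro ⟨S, hS, h1, h2⟩
    have hsS : ∀ v : Fin n, (if (v : ℕ) ∈ S then (1 : Fin 2) else 0) = 1 ↔ (v : ℕ) ∈ S :=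
      fun v => by simp
    refine ⟨fun v => if (v : ℕ) ∈ S then 1 else 0, ?_, (majorityWinner_iff hw hsS).2 h2⟩
    exact (hb _).2 ((cost_eq_total hS hsS).trans_le h1)

/-- The ends of a path that avoids `Y` are connected in the remaining graph, hence adjacent there,
so the path is not induced. Undirectedness turns an edge of the symmetrized graph back into an arc
in the required direction. -/
theorem net_hits (hu : I.Undirected) {Y : Finset (Fin n)}
    (hY : IsClusterGraph (I.graph.induce ((Y : Set (Fin n))ᶜ))) :
    I.net.Hits (Y.map Fin.valEmbedding) := by
  rintro u - v - w - ⟨hun, hvn, huv⟩ ⟨_, hwn, hvw⟩ huw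
  by_contra! h
  have hmem : ∀ x (hx : x < n), x ∉ Y.map Fin.valEmbedding → (⟨x, hx⟩ : Fin n) ∈ (Y : Set _)ᶜ :=
    fun x hx h h' => h (Finset.mem_map.2 ⟨_, h', rfl⟩)
  have hadj : ∀ x y (hx : x < n) (hy : y < n), (x = y ∨ I.arc ⟨x, hx⟩ ⟨y, hy⟩) → x ≠ y →
      I.graph.Adj ⟨x, hx⟩ ⟨y, hy⟩ := fun x y hx hy h hxy =>
    (SimpleGraph.fromRel_adj _ _ _).2 ⟨fun e => hxy (congrArg Fin.val e), Or.inl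
      (h.resolve_left hxy)⟩
  have n1 : u ≠ v := by rintro rfl; exact huw ⟨hun, hwn, hvw⟩
  have n2 : v ≠ w := by rintro rfl; exact huw ⟨hun, hvn, huv⟩
  have n3 : u ≠ w := by rintro rfl; exact huw ⟨hun, hun, Or.inl rfl⟩
  let G := I.graph.induce ((Y : Set (Fin n))ᶜ)
  let u' : ↥((Y : Set (Fin n))ᶜ) := ⟨⟨u, hun⟩, hmem u hun h.1⟩
  let v' : ↥((Y : Set (Fin n))ᶜ) := ⟨⟨v, hvn⟩, hmem v hvn h.2.1⟩
  let w' : ↥((Y : Set (Fin n))ᶜ) := ⟨⟨w, hwn⟩, hmem w hwn h.2.2⟩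
  have a1 : G.Adj u' v' := hadj u v hun hvn huv n1
  have a2 : G.Adj v' w' := hadj v w hvn hwn hvw n2
  have a3 : I.graph.Adj ⟨u, hun⟩ ⟨w, hwn⟩ := hY u' w' (a1.reachable.trans a2.reachable)
    fun e => n3 (congrArg (fun x : ↥((Y : Set (Fin n))ᶜ) => (x.1 : ℕ)) e)
  rcases ((SimpleGraph.fromRel_adj _ _ _).1 a3).2 with h | h
  · exact huw ⟨hun, hwn, Or.inr h⟩
  · exact huw ⟨hun, hwn, Or.inr (hu _ _ h)⟩

theorem exists_hits (hu : I.Undirected) :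
    ∃ Y, I.net.Hits Y ∧ Y.card = clusterVertexDeletionNumber I.graph := by
  have hne : {k | ∃ X : Finset (Fin n), X.card = k ∧
      IsClusterGraph (I.graph.induce ((X : Set (Fin n))ᶜ))}.Nonempty :=
    -- Deleting all vertices leaves the empty graph, so the infimum is attained.
    ⟨_, Finset.univ, rfl, fun u => absurd (Finset.mem_coe.2 (Finset.mem_univ _)) u.2⟩
  obtain ⟨Y, h1, h2⟩ := Nat.sInf_mem hne
  exact ⟨_, net_hits hu h2, by rw [Finset.card_map, h1]; rfl⟩

theorem input_prepare (hu : I.Undirected) :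
    ∃ C : Clustering I.net, Holds C (prepare.run I.input) ∧
      C.size ≤ 2 ^ (3 * clusterVertexDeletionNumber I.graph) := by
  obtain ⟨Y, hY, hYc⟩ := exists_hits hu
  refine (run_prepare (S := I.input) (N := I.net) rfl rfl ?_ ?_ ?_ ?_ ?_).imp
    fun C h => ⟨h.1, hYc ▸ h.2 Y hY⟩
  · intro u hu v hv
    have hu : u < n := hu
    have hv : v < n := hv
    by_cases ha : I.arc ⟨u, hu⟩ ⟨v, hv⟩ <;> simp [input, net, hu, hv, ha]
  · rintro u v ⟨hun, hvn, huv⟩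
    exact ⟨hvn, hun, huv.imp Eq.symm (hu _ _)⟩
  · intro v hv
    have hv : v < n := hv
    have hc : (I.preferred : ℕ) ≤ 1 := Nat.le_of_lt_succ I.preferred.isLt
    simp [input, net, hv, hc]
  · intro v hv
    have hv : v < n := hv
    simp [input, net, hv]
  · intro a ha v
    have h0 : a ≠ 0 := by omega
    have h1 : a ≠ 1 := by omega
    have h2 : a ≠ 2 := by omega
    simp [input, h0, h1, h2]

end Instance

/-- The algorithm for Shift Bribery. -/
def solve : Program :=
  .seq prepare.compile (.seq search.compile (.setReg 0 (.reg 3)))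

theorem solve_decidesWithin : ∃ c d : ℕ, ∀ (n : ℕ) (I : Instance 2 n),
    I.Undirected → I.UniformWeights →
      solve.DecidesWithin I
        (c * (2 ^ (3 * clusterVertexDeletionNumber I.graph)) ^ d * I.pseudoSize ^ d) := by
  -- The phases are timed separately: registers `5` and `6` bound loops of the search but are
  -- written during the preparation, so a single list of constant bounds would not do.
  obtain ⟨c₁, d₁, e₁⟩ := exists_exec (B := [0]) prepare rfl
  obtain ⟨c₂, d₂, e₂⟩ := exists_exec (B := [0, 5, 6]) search rfl
  refine ⟨c₁ + c₂ + 2, d₁ + d₂, fun n I hu hw => ?_⟩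
  obtain ⟨C, hC, hsize⟩ := Instance.input_prepare hu
  set q := 2 ^ (3 * clusterVertexDeletionNumber I.graph) with hq
  have hq1 : 1 ≤ q := Nat.one_le_two_pow
  have hs1 : n + 1 ≤ I.pseudoSize := by unfold Instance.pseudoSize; omega
  -- One number above all loop bounds `n`, `n + 1` and `C.size ≤ q`.
  obtain ⟨M, hM⟩ : ∃ M, M = q * I.pseudoSize := ⟨_, rfl⟩
  have hMs : I.pseudoSize ≤ M := hM ▸ Nat.le_mul_of_pos_left _ hq1
  have hMq : q ≤ M := hM ▸ Nat.le_mul_of_pos_right _ (by omega)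
  have hM1 : 1 ≤ M := hq1.trans hMq
  have h0 : I.input.reg 0 = n := rfl
  obtain ⟨t₁, ht₁, x₁⟩ := e₁ M hM1 I.input (by simp [h0]; omega)
  obtain ⟨t₂, ht₂, x₂⟩ := e₂ M hM1 (prepare.run I.input) (by
    have : I.net.n = n := rfl
    simp only [List.mem_cons, List.not_mem_nil, or_false, forall_eq_or_imp, forall_eq, hC.n,
      hC.size, hC.bound]
    omega)
  have h3 : (prepare.run I.input).reg 3 = 0 := by
    rw [(frame_run prepare I.input).reg 3 rfl]
    simp [Instance.input]
  refine ⟨_, _, Exec.seq x₁ (Exec.seq x₂ (Exec.setReg 0 (.reg 3) _)), ?_, ?_⟩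
  · rw [mul_assoc, ← mul_pow, ← hM]
    have p₁ : M ^ d₁ ≤ M ^ (d₁ + d₂) := Nat.pow_le_pow_right hM1 (by omega)
    have p₂ : M ^ d₂ ≤ M ^ (d₁ + d₂) := Nat.pow_le_pow_right hM1 (by omega)
    have p₃ : 1 ≤ M ^ (d₁ + d₂) := Nat.one_le_pow _ _ hM1
    calc t₁ + (t₂ + ((Expr.reg 3).time + 1))
        ≤ c₁ * M ^ d₁ + (c₂ * M ^ d₂ + 2 * 1) := by simp only [Expr.time]; omega
      _ ≤ c₁ * M ^ (d₁ + d₂) + (c₂ * M ^ (d₁ + d₂) + 2 * M ^ (d₁ + d₂)) := by gcongr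
      _ = _ := by ring
  · have := run_search hC h3
    rw [IsFlag, ← Instance.isYes_iff hw] at this
    simpa [Expr.eval] using this

/-! ### Monotonicity and computability of the time bound. -/

theorem Program.DecidesWithin.mono {p : Program} {n : ℕ} {I : Instance 2 n} {T T' : ℕ}
    (h : p.DecidesWithin I T) (hT : T ≤ T') : p.DecidesWithin I T' := by
  obtain ⟨S, t, h1, h2, h3⟩ := h
  exact ⟨S, t, h1, h2.trans hT, h3⟩

theorem primrec_pow_const {f : ℕ → ℕ} (hf : Primrec f) (d : ℕ) :
    Primrec fun k => f k ^ d := by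
  induction d with
  | zero => simpa using Primrec.const 1
  | succ d ih => simpa only [pow_succ] using Primrec.nat_mul.comp ih hf

theorem primrec_const_pow (b : ℕ) : Primrec fun k => b ^ k :=
  (Primrec.nat_rec₁ 1 (f := fun _ r => r * b)
    (Primrec.nat_mul.comp Primrec.snd (Primrec.const b))).of_eq fun k => by
      induction k with
      | zero => rfl
      | succ k ih => rw [pow_succ, ← ih]

end ShiftBribery

theorem mainTheorem8 :
    (∀ k : ℕ, ∃ (p : ShiftBribery.Program) (C c : ℕ),
      ∀ (n : ℕ) (I : ShiftBribery.Instance 2 n),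
        I.Undirected → I.UniformWeights → I.LinearCosts →
        ShiftBribery.clusterVertexDeletionNumber I.graph ≤ k →
          p.DecidesWithin I (C * I.pseudoSize ^ c)) ∧
    (∃ (p : ShiftBribery.Program) (f : ℕ → ℕ) (c : ℕ), Computable f ∧
      ∀ (n : ℕ) (I : ShiftBribery.Instance 2 n),
        I.Undirected → I.UniformWeights → I.LinearCosts →
          p.DecidesWithin I
            (f (ShiftBribery.clusterVertexDeletionNumber I.graph) * I.pseudoSize ^ c)) := by
  obtain ⟨c, d, h⟩ := ShiftBribery.solve_decidesWithin
  -- The same program serves both claims: for the first, the factor depending on the deletion number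
  -- is evaluated at the constant `k`, in which it is monotone; for the second, it is primitive
  -- recursive.
  refine ⟨fun k => ⟨ShiftBribery.solve, c * (2 ^ (3 * k)) ^ d, d, fun n I hu hw _ hk => ?_⟩,
    ShiftBribery.solve, fun k => c * (2 ^ (3 * k)) ^ d, d, ?_, fun n I hu hw _ => h n I hu hw⟩
  · refine (h n I hu hw).mono ?_
    gcongr
    exact one_le_two
  · refine Primrec.to_comp (Primrec.nat_mul.comp (Primrec.const c)
      (ShiftBribery.primrec_pow_const ?_ d))
    exact (ShiftBribery.primrec_const_pow 2).comp
      (Primrec.nat_mul.comp (Primrec.const 3) Primrec.id)
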